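/- Let $n\ge 0$ and $k\ge 1$, and let $H=\sum_{R\in\mathcal E}h_R$ be a $k$-local Hamiltonian on $n$ qubits: $\mathcal E$ is a set of hyperedges $R\subseteq\{1,\dots,n\}$ with $|R|\le k$, each $h_R$ is a real linear combination of Pauli words acting non-trivially only inside $R$, and $\|h_R\|\le 1$ in spectral norm. Assume that the hypergraph is triangle-free: there are no three distinct vertices $a,b,c$ and three distinct hyperedges $R_0\supseteq\{a,b\}$, $R_1\supseteq\{a,c\}$, $R_2\supseteq\{b,c\}$. Let $d$ be the maximum number of hyperedges containing a common vertex, and let $$f(H)=\sum_{P}\Big(\frac{\mathrm{Tr}(\sigma_P H)}{2^n}\Big)^2,$$ where $P$ runs over the Pauli words $\sigma_P$ with exactly $k$ non-identity factors. There is a randomized algorithm, the same for all such $n$, $k$ and $H$, which, given $n$, $k$ and any list of real multiples of Pauli words with sum $H$, outputs (the Bloch vectors of) a random product state $|v\rangle=|v_1\rangle\otimes\dots\otimes|v_n\rangle$ of unit vectors in time polynomial in $n$ and the number of listed terms, such that $$\mathbb E_v\,\langle v|H|v\rangle\;\le\;\frac{\mathrm{Tr}(H)}{2^n}-\Omega\!\left(\frac{f(H)}{\sqrt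 d\;3^{O(k)}\,2^{O(k)}}\right),$$ that is, there are absolute constants $c>0$ and $C_1,C_2\in\mathbb N$ with $\mathbb E_v\langle v|H|v\rangle\le \mathrm{Tr}(H)/2^n-c\,f(H)/(\sqrt d\,3^{C_1k}2^{C_2k})$ (the subtracted term is read as $0$ if $d=0$, in which case $f(H)=0$). Time is counted on a random access machine with integer and real memory cells that adds, subtracts and compares integers and reals and tosses fair coins, at unit cost per operation. -/

import Mathlib

/-! ### Qubits, Pauli words, local Hamiltonians -/

/-- Operators on `n` qubits, as matrices in the computational basis `{0,1}ⁿ`. -/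
abbrev QubitOp (n : ℕ) : Type := Matrix (Fin n → Fin 2) (Fin n → Fin 2) ℂ

/-- The single-qubit Pauli matrices `I, X, Y, Z`, indexed by `0, 1, 2, 3`. -/
noncomputable def pauli : Fin 4 → Matrix (Fin 2) (Fin 2) ℂ :=
  ![1, !![0, 1; 1, 0], !![0, -Complex.I; Complex.I, 0], !![1, 0; 0, -1]]

/-- The Pauli word `σ_{P 0} ⊗ ⋯ ⊗ σ_{P (n-1)}`. -/
noncomputable def pauliWord {n : ℕ} (P : Fin n → Fin 4) : QubitOp n :=
  Matrix.of fun x y => ∏ i, pauli (P i) (x i) (y i)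

/-- The set of qubits on which a Pauli word acts by a non-identity Pauli matrix. -/
def pauliSupport {n : ℕ} (P : Fin n → Fin 4) : Finset (Fin n) :=
  Finset.univ.filter fun i => P i ≠ 0

/-- The coefficient `Tr(σ_P O) / 2ⁿ` of `σ_P` in the Pauli expansion of a Hermitian operator. -/
noncomputable def pauliCoeff {n : ℕ} (O : QubitOp n) (P : Fin n → Fin 4) : ℝ :=
  (Matrix.trace (pauliWord P * O)).re / 2 ^ n

/-- `f(O)`: the sum of the squared Pauli coefficients of the strictly `k`-local terms, i.e. of the
Pauli words with exactly `k` non-identity factors. -/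
noncomputable def strictWeight {n : ℕ} (k : ℕ) (O : QubitOp n) : ℝ :=
  ∑ P : Fin n → Fin 4 with (pauliSupport P).card = k, pauliCoeff O P ^ 2

/-- The family `(h R)`, `R` a hyperedge, is a family of `k`-local interaction terms: every
hyperedge has at most `k` vertices, `h R` is a real linear combination of Pauli words acting
non-trivially only inside `R`, and its spectral norm is at most one. -/
def IsLocalFamily {n : ℕ} (k : ℕ) (E : Finset (Finset (Fin n)))
    (h : Finset (Fin n) → QubitOp n) : Prop :=
  ∀ R ∈ E, R.card ≤ k ∧
    h R ∈ Submodule.span ℝ {A : QubitOp n | ∃ P, pauliSupport P ⊆ R ∧ A = pauliWord P} ∧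
    ‖Matrix.toEuclideanCLM (𝕜 := ℂ) (h R)‖ ≤ 1

/-- No three distinct vertices `a, b, c` are pairwise joined by three distinct hyperedges. -/
def HypergraphTriangleFree {n : ℕ} (E : Finset (Finset (Fin n))) : Prop :=
  ∀ R₀ ∈ E, ∀ R₁ ∈ E, ∀ R₂ ∈ E, R₀ ≠ R₁ → R₁ ≠ R₂ → R₀ ≠ R₂ →
    ∀ a b c : Fin n, a ≠ b → c ≠ a → c ≠ b →
      ¬ ((a ∈ R₀ ∧ b ∈ R₀) ∧ (c ∈ R₁ ∧ a ∈ R₁) ∧ (c ∈ R₂ ∧ b ∈ R₂))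

/-- The maximum over the vertices of the number of hyperedges containing the vertex. -/
def hypergraphMaxDegree {n : ℕ} (E : Finset (Finset (Fin n))) : ℕ :=
  Finset.univ.sup fun i => (E.filter fun R => i ∈ R).card

/-- The product vector `|v 0⟩ ⊗ ⋯ ⊗ |v (n-1)⟩`. -/
def productState {n : ℕ} (v : Fin n → Fin 2 → ℂ) : (Fin n → Fin 2) → ℂ :=
  fun x => ∏ i, v i (x i)

/-- The energy `⟨ψ|H|ψ⟩`. -/
noncomputable def energy {n : ℕ} (H : QubitOp n) (ψ : (Fin n → Fin 2) → ℂ) : ℝ :=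
  (star ψ ⬝ᵥ H.mulVec ψ).re

/-- The Bloch vector `(⟨ψ|X|ψ⟩, ⟨ψ|Y|ψ⟩, ⟨ψ|Z|ψ⟩)` of a single-qubit state. -/
noncomputable def blochVector (ψ : Fin 2 → ℂ) (a : Fin 3) : ℝ :=
  (star ψ ⬝ᵥ (pauli a.succ).mulVec ψ).re

/-! ### Randomized algorithms over the reals

A random access machine with integer and real memory, programmed in a while-language. Integers and
reals may be added, subtracted and compared, and fair coins may be tossed; every assignment, coin
toss and test costs one time unit. Memory is organized in arrays, whose names are fixed numbers in
the program, and whose indices can be computed. There is no multiplication, no rounding, and no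
real constant other than `0` and `1`: on rational data the numbers that occur in polynomially many
steps have polynomial bit length. -/

namespace RealRAM

/-- Integer expressions; `get a e` is the entry with index `e` of the integer array `a`. -/
inductive NatExpr : Type
  | const (c : ℕ)
  | get (a : ℕ) (e : NatExpr)
  | add (e₁ e₂ : NatExpr)
  | sub (e₁ e₂ : NatExpr)

/-- Real expressions; `get a e` is the entry with index `e` of the real array `a`. -/
inductive RealExpr : Type
  | zero
  | one
  | get (a : ℕ) (e : NatExpr)
  | add (r₁ r₂ : RealExpr)
  | sub (r₁ r₂ : RealExpr)

/-- Tests. -/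
inductive Test : Type
  | natLt (e₁ e₂ : NatExpr)
  | realLt (r₁ r₂ : RealExpr)

/-- Programs. -/
inductive Cmd : Type
  | skip
  | setNat (a : ℕ) (e : NatExpr) (val : NatExpr)
  | setReal (a : ℕ) (e : NatExpr) (val : RealExpr)
  | toss (a : ℕ) (e : NatExpr)
  | seq (c₁ c₂ : Cmd)
  | ite (b : Test) (c₁ c₂ : Cmd)
  | loop (b : Test) (c : Cmd)

/-- Memory: `nat a i` and `real a i` are the entries with index `i` of the arrays `a`, and `coins`
is the number of coins tossed so far. -/
structure State : Type where
  nat : ℕ → ℕ → ℕ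
  real : ℕ → ℕ → ℝ
  coins : ℕ

/-- The value of an integer expression (a negative difference is replaced by zero). -/
def NatExpr.eval (s : State) : NatExpr → ℕ
  | const c => c
  | get a e => s.nat a (e.eval s)
  | add e₁ e₂ => e₁.eval s + e₂.eval s
  | sub e₁ e₂ => e₁.eval s - e₂.eval s

/-- The value of a real expression. -/
noncomputable def RealExpr.eval (s : State) : RealExpr → ℝ
  | zero => 0
  | one => 1
  | get a e => s.real a (e.eval s)
  | add r₁ r₂ => r₁.eval s + r₂.eval s
  | sub r₁ r₂ => r₁.eval s - r₂.eval s

/-- The truth value of a test. -/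
def Test.Holds (s : State) : Test → Prop
  | natLt e₁ e₂ => e₁.eval s < e₂.eval s
  | realLt r₁ r₂ => r₁.eval s < r₂.eval s

/-- Overwrite one entry of one array. -/
def State.setNat (s : State) (a i x : ℕ) : State :=
  { s with nat := Function.update s.nat a (Function.update (s.nat a) i x) }

/-- Overwrite one entry of one array. -/
noncomputable def State.setReal (s : State) (a i : ℕ) (x : ℝ) : State :=
  { s with real := Function.update s.real a (Function.update (s.real a) i x) }

/-- `Exec ω c s t s'`: with coin tosses `ω`, the program `c` started in state `s` halts in state
`s'` after exactly `t` time units. -/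
inductive Exec (ω : ℕ → Bool) : Cmd → State → ℕ → State → Prop
  | skip (s : State) : Exec ω Cmd.skip s 1 s
  | setNat (a : ℕ) (e val : NatExpr) (s : State) :
      Exec ω (Cmd.setNat a e val) s 1 (s.setNat a (e.eval s) (val.eval s))
  | setReal (a : ℕ) (e : NatExpr) (val : RealExpr) (s : State) :
      Exec ω (Cmd.setReal a e val) s 1 (s.setReal a (e.eval s) (val.eval s))
  | toss (a : ℕ) (e : NatExpr) (s : State) :
      Exec ω (Cmd.toss a e) s 1
        { s.setNat a (e.eval s) (ω s.coins).toNat with coins := s.coins + 1 }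
  | seq {c₁ c₂ : Cmd} {s s₁ s₂ : State} {t₁ t₂ : ℕ} :
      Exec ω c₁ s t₁ s₁ → Exec ω c₂ s₁ t₂ s₂ → Exec ω (Cmd.seq c₁ c₂) s (t₁ + t₂) s₂
  | ite_true {b : Test} {c₁ c₂ : Cmd} {s s₁ : State} {t : ℕ} :
      b.Holds s → Exec ω c₁ s t s₁ → Exec ω (Cmd.ite b c₁ c₂) s (t + 1) s₁
  | ite_false {b : Test} {c₁ c₂ : Cmd} {s s₁ : State} {t : ℕ} :
      ¬ b.Holds s → Exec ω c₂ s t s₁ → Exec ω (Cmd.ite b c₁ c₂) s (t + 1) s₁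
  | loop_done {b : Test} {c : Cmd} {s : State} :
      ¬ b.Holds s → Exec ω (Cmd.loop b c) s 1 s
  | loop_step {b : Test} {c : Cmd} {s s₁ s₂ : State} {t₁ t₂ : ℕ} :
      b.Holds s → Exec ω c s t₁ s₁ → Exec ω (Cmd.loop b c) s₁ t₂ s₂ →
        Exec ω (Cmd.loop b c) s (t₁ + t₂ + 1) s₂

/-- The coin tosses given by a finite random tape. A run of at most `T` time units looks at the
first `T` coins only. -/
def tape {T : ℕ} (r : Fin T → Bool) : ℕ → Bool :=
  fun j => if hj : j < T then r ⟨j, hj⟩ else false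

end RealRAM

/-- The list of real multiples of Pauli words adds up to `H`. -/
def PauliSumOf {n : ℕ} (L : List (ℝ × (Fin n → Fin 4))) (H : QubitOp n) : Prop :=
  (L.map fun q => (q.1 : ℂ) • pauliWord q.2).sum = H

/-- The input: `n`, `k` and the number of terms are the first entries of the integer array `0`;
the letters of the words are listed, word after word, in the integer array `1`; the coefficients
are listed in the real array `0`. All other entries are zero. -/
noncomputable def inputState {n : ℕ} (k : ℕ) (L : List (ℝ × (Fin n → Fin 4))) : RealRAM.State where
  nat a j :=
    if a = 0 then [n, k, L.length].getD j 0
    else if a = 1 then (L.flatMap fun q => List.ofFn fun i => (q.2 i : ℕ)).getD j 0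
    else 0
  real a j := if a = 0 then (L.map Prod.fst).getD j 0 else 0
  coins := 0

/-- The output: the product of the unit vectors `v i` is written down if the Bloch vector of `v i`
stands in the entries `3 i`, `3 i + 1`, `3 i + 2` of the real array `1`. -/
def OutputsState {n : ℕ} (s : RealRAM.State) (v : Fin n → Fin 2 → ℂ) : Prop :=
  ∀ i : Fin n, star (v i) ⬝ᵥ v i = 1 ∧
    ∀ a : Fin 3, s.real 1 (3 * (i : ℕ) + (a : ℕ)) = blochVector (v i) a

/-! ### A greedy product state

Every qubit is given a random one of the three Pauli bases, and a random sign `y i`. In the chosen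
bases the energy of a product of basis states is a multilinear polynomial
`∑ S, a S * ∏ i ∈ S, y i` in the signs, where `a S` is the Pauli coefficient of the one word on `S`
that agrees with the bases (`energy_productState`). A random half `U` of the qubits is then allowed
to be greedy: `i ∈ U` replaces its sign by the one opposed to its local field, the sum of
`a S * ∏ l ∈ S \ {i}, y l` over the sets `S` of size `k` with `S ∩ U = {i}`. Only additions are
needed to compute the local fields from the list of terms.

The heart of the matter is that every other monomial but the constant has mean zero at the greedy
point, so that the mean energy is `a ∅ - ∑ i, E |local field of i|` (`sum_polynomial_greedyCoins`).
In a triangle-free hypergraph a hyperedge `R` of full size `k` through `i` has a private vertex, one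
that shares no other hyperedge with `i` (`exists_private_vertex`). Flipping the private vertices of
all active hyperedges at `i` negates the local field of `i`; by triangle-freeness it does not affect
the local fields of the other greedy vertices of a hyperedge at `i`. Nearly every unwanted monomial
is averaged out by such a flip (`sum_character_greedyCoins_eq_zero_of_notMem`); those inside an
active hyperedge that contain its private vertex need another one
(`sum_character_greedyCoins_eq_zero_of_mem`).

The private vertices also make the monomials of a local field independent signs, hence a Khintchine
inequality (`le_sum_abs_of_private`) applies. There are at most `d` of them, with no coefficient
above one in absolute value, so it bounds `E |local field of i|` below by half the sum of the
squared coefficients, divided by `√d`. Finally, a given word of weight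
`k` agrees with the bases and meets `U` in one given letter with probability at least `8 ^ (-k)`
(`card_good_coins_ge`), because two fair coins give each basis probability at least `1 / 4`.

The program `greedyProgram` is verified with Hoare-style rules that keep track of time
(`RealRAM.Runs`); what it computes is stated in `greedyProgram_spec`. -/

/-! ### Pauli words and product states -/

/-- The tensor product of one-qubit operators. -/
def tensorOp {n : ℕ} (M : Fin n → Matrix (Fin 2) (Fin 2) ℂ) : QubitOp n :=
  Matrix.of fun x y => ∏ i, M i (x i) (y i)

theorem sum_pi_prod {n : ℕ} (f : Fin n → Fin 2 → ℂ) :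
    ∑ x : Fin n → Fin 2, ∏ i, f i (x i) = ∏ i, ∑ a, f i a := by
  rw [Finset.prod_univ_sum, Fintype.piFinset_univ]

theorem tensorOp_mul {n : ℕ} (M N : Fin n → Matrix (Fin 2) (Fin 2) ℂ) :
    tensorOp M * tensorOp N = tensorOp fun i => M i * N i := by
  ext x z
  simp only [tensorOp, Matrix.mul_apply, Matrix.of_apply, ← Finset.prod_mul_distrib]
  exact sum_pi_prod fun i a => M i (x i) a * N i a (z i)

theorem trace_tensorOp {n : ℕ} (M : Fin n → Matrix (Fin 2) (Fin 2) ℂ) :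
    (tensorOp M).trace = ∏ i, (M i).trace := by
  simp only [Matrix.trace, tensorOp, Matrix.diag_apply, Matrix.of_apply]
  exact sum_pi_prod fun i a => M i a a

theorem tensorOp_conjTranspose {n : ℕ} (M : Fin n → Matrix (Fin 2) (Fin 2) ℂ) :
    (tensorOp M).conjTranspose = tensorOp fun i => (M i).conjTranspose := by
  ext x y
  simp [tensorOp, Matrix.conjTranspose_apply]

theorem tensorOp_one {n : ℕ} : tensorOp (fun _ : Fin n => 1) = 1 := by
  ext x y
  simp only [tensorOp, Matrix.of_apply, Matrix.one_apply]
  by_cases h : x = y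
  · simp [h]
  · obtain ⟨i, hi⟩ := Function.ne_iff.mp h
    rw [if_neg h]
    exact Finset.prod_eq_zero (Finset.mem_univ i) (by simp [hi])

theorem expectation_tensorOp {n : ℕ} (M : Fin n → Matrix (Fin 2) (Fin 2) ℂ)
    (v : Fin n → Fin 2 → ℂ) :
    star (productState v) ⬝ᵥ (tensorOp M).mulVec (productState v) =
      ∏ i, star (v i) ⬝ᵥ (M i).mulVec (v i) := by
  simp only [dotProduct, Matrix.mulVec, productState, tensorOp, Matrix.of_apply, Pi.star_apply,
    star_prod, ← Finset.prod_mul_distrib]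
  have h : ∀ x : Fin n → Fin 2, ∑ y : Fin n → Fin 2, ∏ i, M i (x i) (y i) * v i (y i) =
      ∏ i, ∑ b, M i (x i) b * v i b := fun x => sum_pi_prod fun i b => M i (x i) b * v i b
  simp only [h, ← Finset.prod_mul_distrib]
  exact sum_pi_prod fun i a => star (v i a) * ∑ b, M i a b * v i b

theorem pauliWord_eq_tensorOp {n : ℕ} (P : Fin n → Fin 4) :
    pauliWord P = tensorOp fun i => pauli (P i) := rfl

theorem pauli_mul_self (p : Fin 4) : pauli p * pauli p = 1 := by
  fin_cases p <;> simp [pauli, Matrix.one_fin_two]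

theorem pauli_conjTranspose (p : Fin 4) : (pauli p).conjTranspose = pauli p := by
  fin_cases p <;> ext i j <;> fin_cases i <;> fin_cases j <;>
    simp [pauli, Matrix.conjTranspose_apply]

theorem trace_pauli_mul (p q : Fin 4) :
    (pauli p * pauli q).trace = if p = q then 2 else 0 := by
  fin_cases p <;> fin_cases q <;> simp [pauli, Matrix.trace_fin_two, Matrix.one_fin_two] <;>
    norm_num

theorem pauliWord_mul_self {n : ℕ} (P : Fin n → Fin 4) : pauliWord P * pauliWord P = 1 := by
  simp only [pauliWord_eq_tensorOp, tensorOp_mul, pauli_mul_self, tensorOp_one]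

theorem trace_pauliWord_mul {n : ℕ} (P Q : Fin n → Fin 4) :
    (pauliWord P * pauliWord Q).trace = if P = Q then 2 ^ n else 0 := by
  simp only [pauliWord_eq_tensorOp, tensorOp_mul, trace_tensorOp, trace_pauli_mul]
  by_cases h : P = Q
  · simp [h]
  · obtain ⟨i, hi⟩ := Function.ne_iff.mp h
    rw [if_neg h]
    exact Finset.prod_eq_zero (Finset.mem_univ i) (by simp [hi])

theorem pauliWord_zero {n : ℕ} : pauliWord (0 : Fin n → Fin 4) = 1 := by
  simp [pauliWord_eq_tensorOp, pauli, tensorOp_one]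

/-- The Pauli coefficient as a real linear functional. -/
noncomputable def pauliCoeffLinear {n : ℕ} (P : Fin n → Fin 4) : QubitOp n →ₗ[ℝ] ℝ where
  toFun O := pauliCoeff O P
  map_add' A B := by simp [pauliCoeff, mul_add, add_div]
  map_smul' c A := by simp [pauliCoeff, mul_div_assoc]

theorem pauliCoeffLinear_pauliWord {n : ℕ} (P Q : Fin n → Fin 4) :
    pauliCoeffLinear P (pauliWord Q) = if Q = P then 1 else 0 := by
  change pauliCoeff _ _ = _
  rw [pauliCoeff, trace_pauliWord_mul]
  by_cases h : Q = P
  · have : ((2 : ℂ) ^ n).re = 2 ^ n := by norm_cast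
    simp [h, this]
  · simp [h, Ne.symm h]

theorem pauliCoeff_zero_eq {n : ℕ} (O : QubitOp n) : pauliCoeff O 0 = O.trace.re / 2 ^ n := by
  simp [pauliCoeff, pauliWord_zero]

/-- The energy of a fixed vector as a real linear functional of the Hamiltonian. -/
noncomputable def energyLinear {n : ℕ} (ψ : (Fin n → Fin 2) → ℂ) : QubitOp n →ₗ[ℝ] ℝ where
  toFun O := energy O ψ
  map_add' A B := by simp [energy, Matrix.add_mulVec, dotProduct_add]
  map_smul' c A := by
    simp [energy, Matrix.smul_mulVec, dotProduct_smul]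

theorem pauliSum_apply {n : ℕ} {L : List (ℝ × (Fin n → Fin 4))} {H : QubitOp n}
    (hL : PauliSumOf L H) (φ : QubitOp n →ₗ[ℝ] ℝ) :
    φ H = (L.map fun q => q.1 * φ (pauliWord q.2)).sum := by
  subst hL
  induction L with
  | nil => simp
  | cons q L ih =>
    simp only [List.map_cons, List.sum_cons, map_add, ih]
    congr 1
    have : ((q.1 : ℂ) • pauliWord q.2) = q.1 • pauliWord q.2 := by
      ext; simp
    rw [this, map_smul, smul_eq_mul]

/-- A sum over the listed terms is the corresponding sum over the Pauli expansion, so that repeated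
words in the list do not matter. -/
theorem list_sum_eq_sum_pauliCoeff {n : ℕ} {L : List (ℝ × (Fin n → Fin 4))} {H : QubitOp n}
    (hL : PauliSumOf L H) (F : (Fin n → Fin 4) → ℝ) :
    (L.map fun q => q.1 * F q.2).sum = ∑ P, pauliCoeff H P * F P := by
  have h : ∀ P, pauliCoeff H P = (L.map fun q => q.1 * if q.2 = P then 1 else 0).sum := fun P => by
    have := pauliSum_apply hL (pauliCoeffLinear P)
    simp only [pauliCoeffLinear_pauliWord] at this
    exact this
  simp only [h]
  clear h hL
  induction L with
  | nil => simp
  | cons q L ih => simp [ih, add_mul, Finset.sum_add_distrib]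

theorem energy_eq_sum_pauliCoeff {n : ℕ} {L : List (ℝ × (Fin n → Fin 4))} {H : QubitOp n}
    (hL : PauliSumOf L H) (ψ : (Fin n → Fin 2) → ℂ) :
    energy H ψ = ∑ P, pauliCoeff H P * energy (pauliWord P) ψ := by
  rw [← list_sum_eq_sum_pauliCoeff hL fun P => energy (pauliWord P) ψ]
  exact pauliSum_apply hL (energyLinear ψ)

theorem norm_pauliWord_le {n : ℕ} (P : Fin n → Fin 4) :
    ‖Matrix.toEuclideanCLM (𝕜 := ℂ) (pauliWord P)‖ ≤ 1 := by
  set U := Matrix.toEuclideanCLM (𝕜 := ℂ) (pauliWord P) with hU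
  have hstar : star U = U := by
    rw [hU, ← map_star]
    congr 1
    simp only [Matrix.star_eq_conjTranspose, pauliWord_eq_tensorOp, tensorOp_conjTranspose,
      pauli_conjTranspose]
  have hsq : U * U = 1 := by rw [hU, ← map_mul, pauliWord_mul_self, map_one]
  have h : ‖U‖ * ‖U‖ = ‖U * U‖ := by rw [← CStarRing.norm_star_mul_self, hstar]
  have h1 : ‖U * U‖ ≤ 1 := by
    rw [hsq]
    exact ContinuousLinearMap.norm_id_le
  nlinarith [norm_nonneg U]

theorem norm_diag_le {n : ℕ} (A : QubitOp n) (x : Fin n → Fin 2) :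
    ‖A x x‖ ≤ ‖Matrix.toEuclideanCLM (𝕜 := ℂ) A‖ := by
  have h := (Matrix.toEuclideanCLM (𝕜 := ℂ) A).le_opNorm (EuclideanSpace.single x 1)
  have h2 := PiLp.norm_apply_le (Matrix.toEuclideanCLM (𝕜 := ℂ) A (EuclideanSpace.single x 1)) x
  have h3 : Matrix.toEuclideanCLM (𝕜 := ℂ) A (EuclideanSpace.single x 1) x = A x x := by
    simp [EuclideanSpace.single]
  rw [h3] at h2
  simpa using h2.trans h

theorem abs_pauliCoeff_le {n : ℕ} (A : QubitOp n) (P : Fin n → Fin 4)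
    (hA : ‖Matrix.toEuclideanCLM (𝕜 := ℂ) A‖ ≤ 1) : |pauliCoeff A P| ≤ 1 := by
  have h1 : ‖Matrix.toEuclideanCLM (𝕜 := ℂ) (pauliWord P * A)‖ ≤ 1 := by
    rw [map_mul]
    exact (norm_mul_le _ _).trans (mul_le_one₀ (norm_pauliWord_le P) (norm_nonneg _) hA)
  have h2 : ‖(pauliWord P * A).trace‖ ≤ 2 ^ n := by
    calc _ ≤ ∑ x : Fin n → Fin 2, ‖(pauliWord P * A) x x‖ := norm_sum_le _ _
      _ ≤ ∑ x : Fin n → Fin 2, (1 : ℝ) :=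
        Finset.sum_le_sum fun x _ => (norm_diag_le _ x).trans h1
      _ = 2 ^ n := by simp
  rw [pauliCoeff, abs_div, abs_of_pos (a := (2 : ℝ) ^ n) (by positivity)]
  exact div_le_one_of_le₀ ((Complex.abs_re_le_norm _).trans h2) (by positivity)

theorem pauliCoeff_eq_zero_of_span {n : ℕ} {A : QubitOp n} {R : Finset (Fin n)}
    (hA : A ∈ Submodule.span ℝ {A : QubitOp n | ∃ P, pauliSupport P ⊆ R ∧ A = pauliWord P})
    {P : Fin n → Fin 4} (hP : ¬ pauliSupport P ⊆ R) : pauliCoeff A P = 0 := by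
  have : Submodule.span ℝ {A : QubitOp n | ∃ P, pauliSupport P ⊆ R ∧ A = pauliWord P} ≤
      LinearMap.ker (pauliCoeffLinear P) := by
    rw [Submodule.span_le]
    rintro _ ⟨Q, hQ, rfl⟩
    simp only [SetLike.mem_coe, LinearMap.mem_ker, pauliCoeffLinear_pauliWord]
    rw [if_neg]
    rintro rfl
    exact hP hQ
  exact LinearMap.mem_ker.mp (this hA)

theorem pauliCoeff_sum {n : ℕ} (E : Finset (Finset (Fin n))) (h : Finset (Fin n) → QubitOp n)
    (P : Fin n → Fin 4) : pauliCoeff (∑ R ∈ E, h R) P = ∑ R ∈ E, pauliCoeff (h R) P :=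
  map_sum (pauliCoeffLinear P) h E

theorem exists_support_subset {n k : ℕ} {E : Finset (Finset (Fin n))}
    {h : Finset (Fin n) → QubitOp n} (hloc : IsLocalFamily k E h) {P : Fin n → Fin 4}
    (hP : pauliCoeff (∑ R ∈ E, h R) P ≠ 0) : ∃ R ∈ E, pauliSupport P ⊆ R := by
  rw [pauliCoeff_sum] at hP
  obtain ⟨R, hR, hne⟩ := Finset.exists_ne_zero_of_sum_ne_zero hP
  exact ⟨R, hR, by_contra fun hn => hne (pauliCoeff_eq_zero_of_span (hloc R hR).2.1 hn)⟩

/-- A word of full weight `k` occurs only in the interaction term of its own support, and so its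
coefficient is bounded by the norm of that one term. -/
theorem abs_pauliCoeff_le_of_card_eq {n k : ℕ} {E : Finset (Finset (Fin n))}
    {h : Finset (Fin n) → QubitOp n} (hloc : IsLocalFamily k E h) {P : Fin n → Fin 4}
    (hP : (pauliSupport P).card = k) : |pauliCoeff (∑ R ∈ E, h R) P| ≤ 1 := by
  have h0 : ∀ R ∈ E, R ≠ pauliSupport P → pauliCoeff (h R) P = 0 := fun R hR hne =>
    pauliCoeff_eq_zero_of_span (hloc R hR).2.1 fun hsub =>
      hne (Finset.eq_of_subset_of_card_le hsub (by rw [hP]; exact (hloc R hR).1)).symm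
  rw [pauliCoeff_sum]
  by_cases hmem : pauliSupport P ∈ E
  · rw [Finset.sum_eq_single_of_mem _ hmem fun R hR hne => h0 R hR hne]
    exact abs_pauliCoeff_le _ _ (hloc _ hmem).2.2
  · rw [Finset.sum_eq_zero fun R hR => h0 R hR fun he => hmem (he ▸ hR)]
    simp

/-- Every vector of length one along a coordinate axis is a Bloch vector. The expectations are
given as complex numbers, the identity included, because they are factors of the expectations of
Pauli words. -/
theorem exists_qubit_state (b : Fin 4) (hb : b ≠ 0) (ε : ℝ) (hε : ε = 1 ∨ ε = -1) :
    ∃ ψ : Fin 2 → ℂ, ∀ p : Fin 4, star ψ ⬝ᵥ (pauli p).mulVec ψ =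
      if p = 0 then 1 else if p = b then (ε : ℂ) else 0 := by
  obtain ⟨c, hc⟩ : ∃ c : ℝ, c * c = 1 / 2 :=
    ⟨√(1 / 2), Real.mul_self_sqrt (by norm_num)⟩
  fin_cases b
  · exact absurd rfl hb
  · refine ⟨![c, ε * c], fun p => ?_⟩
    fin_cases p <;> rcases hε with rfl | rfl <;>
      simp [pauli, dotProduct, Matrix.mulVec, Fin.sum_univ_two, Complex.ext_iff] <;>
      linarith
  · refine ⟨![c, ε * c * Complex.I], fun p => ?_⟩
    fin_cases p <;> rcases hε with rfl | rfl <;>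
      simp [pauli, dotProduct, Matrix.mulVec, Fin.sum_univ_two, Complex.ext_iff] <;>
      linarith
  · refine ⟨![(1 + ε) / 2, (1 - ε) / 2], fun p => ?_⟩
    fin_cases p <;> rcases hε with rfl | rfl <;>
      simp [pauli, dotProduct, Matrix.mulVec, Fin.sum_univ_two]

/-! ### Random signs -/

/-- The sign `±1` encoded by a coin; `true` stands for `-1`. -/
def coinSign (b : Bool) : ℝ := if b then -1 else 1

theorem coinSign_mul_self (b : Bool) : coinSign b * coinSign b = 1 := by
  cases b <;> simp [coinSign]

theorem coinSign_eq_or (b : Bool) : coinSign b = 1 ∨ coinSign b = -1 := by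
  cases b <;> simp [coinSign]

theorem coinSign_not (b : Bool) : coinSign (!b) = -coinSign b := by
  cases b <;> simp [coinSign]

/-- Flip the coins in `W`. -/
def flipCoins {n : ℕ} (W : Finset (Fin n)) (y : Fin n → Bool) : Fin n → Bool :=
  fun i => if i ∈ W then !(y i) else y i

theorem flipCoins_involutive {n : ℕ} (W : Finset (Fin n)) :
    Function.Involutive (flipCoins W) := by
  intro y
  ext i
  by_cases h : i ∈ W <;> simp [flipCoins, h]

theorem sum_eq_zero_of_flip {n : ℕ} (W : Finset (Fin n)) (F : (Fin n → Bool) → ℝ)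
    (hF : ∀ y, F (flipCoins W y) = -F y) : ∑ y, F y = 0 := by
  have h := Equiv.sum_comp (flipCoins_involutive W).toPerm F
  simp only [Function.Involutive.coe_toPerm, hF, Finset.sum_neg_distrib] at h
  linarith

/-- The parity character of a set of coins. -/
def character {n : ℕ} (S : Finset (Fin n)) (y : Fin n → Bool) : ℝ := ∏ i ∈ S, coinSign (y i)

theorem character_mul_self {n : ℕ} (S : Finset (Fin n)) (y : Fin n → Bool) :
    character S y * character S y = 1 := by
  rw [character, ← Finset.prod_mul_distrib]
  exact Finset.prod_eq_one fun i _ => coinSign_mul_self _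

theorem character_flipCoins {n : ℕ} (S W : Finset (Fin n)) (y : Fin n → Bool) :
    character S (flipCoins W y) = (-1) ^ (S ∩ W).card * character S y := by
  have h : ∀ i ∈ S, coinSign (flipCoins W y i) = (if i ∈ W then -1 else 1) * coinSign (y i) := by
    intro i _
    by_cases h : i ∈ W <;> simp [flipCoins, h, coinSign_not]
  rw [character, Finset.prod_congr rfl h, Finset.prod_mul_distrib, ← Finset.prod_filter,
    Finset.prod_const, Finset.filter_mem_eq_inter, character]

theorem character_flipCoins_of_inter_eq_singleton {n : ℕ} {S W : Finset (Fin n)} {c : Fin n}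
    (h : S ∩ W = {c}) (y : Fin n → Bool) : character S (flipCoins W y) = -character S y := by
  simp [character_flipCoins, h]

theorem character_flipCoins_of_inter_eq_empty {n : ℕ} {S W : Finset (Fin n)}
    (h : S ∩ W = ∅) (y : Fin n → Bool) : character S (flipCoins W y) = character S y := by
  simp [character_flipCoins, h]

theorem sum_character_eq_zero {n : ℕ} {S : Finset (Fin n)} (hS : S.Nonempty) :
    ∑ y, character S y = 0 := by
  obtain ⟨i, hi⟩ := hS
  refine sum_eq_zero_of_flip {i} _ fun y => ?_
  exact character_flipCoins_of_inter_eq_singleton (Finset.inter_singleton_of_mem hi) y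

/-! ### Sums of independent signs -/

/-- Second and fourth moment of a combination of parities, each of which contains a coin that the
others do not contain, and is thus a sign independent of the others. -/
theorem sum_moments_of_private {n : ℕ} (𝒮 : Finset (Finset (Fin n))) (a : Finset (Fin n) → ℝ)
    (c : Finset (Fin n) → Fin n) (hc : ∀ S ∈ 𝒮, c S ∈ S)
    (hc' : ∀ S ∈ 𝒮, ∀ S' ∈ 𝒮, c S ∈ S' → S' = S) :
    (∑ y : Fin n → Bool, (∑ S ∈ 𝒮, a S * character S y) ^ 2 = 2 ^ n * ∑ S ∈ 𝒮, a S ^ 2) ∧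
    ∑ y : Fin n → Bool, (∑ S ∈ 𝒮, a S * character S y) ^ 4 ≤
      2 ^ n * (3 * (∑ S ∈ 𝒮, a S ^ 2) ^ 2) := by
  induction 𝒮 using Finset.induction_on with
  | empty => simp
  | insert R 𝒮 hR ih =>
    obtain ⟨ih2, ih4⟩ := ih (fun S hS => hc S (Finset.mem_insert_of_mem hS))
      (fun S hS S' hS' => hc' S (Finset.mem_insert_of_mem hS) S' (Finset.mem_insert_of_mem hS'))
    set X : (Fin n → Bool) → ℝ := fun y => ∑ S ∈ 𝒮, a S * character S y with hX
    set A := ∑ S ∈ 𝒮, a S ^ 2 with hA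
    have hA0 : 0 ≤ A := Finset.sum_nonneg fun _ _ => sq_nonneg _
    change ∑ y, X y ^ 2 = _ at ih2
    change ∑ y, X y ^ 4 ≤ _ at ih4
    have hXflip : ∀ y, X (flipCoins {c R} y) = X y := fun y => by
      refine Finset.sum_congr rfl fun S hS => ?_
      rw [character_flipCoins_of_inter_eq_empty (Finset.inter_singleton_of_notMem fun hmem => hR ?_)]
      rw [← hc' R (Finset.mem_insert_self _ _) S (Finset.mem_insert_of_mem hS) hmem]
      exact hS
    have hRflip : ∀ y, character R (flipCoins {c R} y) = -character R y :=
      character_flipCoins_of_inter_eq_singleton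
        (Finset.inter_singleton_of_mem (hc R (Finset.mem_insert_self _ _)))
    have hodd : ∀ m : ℕ, ∑ y, X y ^ m * character R y = 0 := fun m =>
      sum_eq_zero_of_flip {c R} _ fun y => by rw [hXflip, hRflip]; ring
    have hcard : (Fintype.card (Fin n → Bool) : ℝ) = 2 ^ n := by simp
    have h2 : ∀ y, (a R * character R y + X y) ^ 2 =
        a R ^ 2 + X y ^ 2 + 2 * a R * (X y ^ 1 * character R y) := fun y => by
      linear_combination a R ^ 2 * character_mul_self R y
    have h4 : ∀ y, (a R * character R y + X y) ^ 4 =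
        a R ^ 4 + 6 * a R ^ 2 * X y ^ 2 + X y ^ 4 + 4 * a R ^ 3 * (X y ^ 1 * character R y) +
          4 * a R * (X y ^ 3 * character R y) := fun y => by
      linear_combination (a R ^ 4 * (character R y ^ 2 + 1) + 6 * a R ^ 2 * X y ^ 2 +
        4 * a R ^ 3 * X y * character R y) * character_mul_self R y
    simp only [Finset.sum_insert hR]
    change (∑ y, (a R * character R y + X y) ^ 2 = 2 ^ n * (a R ^ 2 + A)) ∧
      ∑ y, (a R * character R y + X y) ^ 4 ≤ 2 ^ n * (3 * (a R ^ 2 + A) ^ 2)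
    simp only [h2, h4, Finset.sum_add_distrib, ← Finset.mul_sum, hodd, ih2, Finset.sum_const,
      Finset.card_univ, nsmul_eq_mul, hcard]
    constructor
    · ring
    · have : (0 : ℝ) ≤ 2 ^ n * a R ^ 4 := by positivity
      nlinarith

/-- A Khintchine inequality: it follows from the second and fourth moments by means of the
pointwise bound `|t| ≥ (3 t² s² - t⁴) / (2 s³)`, where `s² = 2 d`. -/
theorem le_sum_abs_of_private {n : ℕ} (𝒮 : Finset (Finset (Fin n))) (a : Finset (Fin n) → ℝ)
    (c : Finset (Fin n) → Fin n) (hc : ∀ S ∈ 𝒮, c S ∈ S)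
    (hc' : ∀ S ∈ 𝒮, ∀ S' ∈ 𝒮, c S ∈ S' → S' = S) (d : ℝ) (hd : 0 < d)
    (had : ∑ S ∈ 𝒮, a S ^ 2 ≤ d) :
    2 ^ n * (1 / 2 * ((∑ S ∈ 𝒮, a S ^ 2) / √d)) ≤
      ∑ y : Fin n → Bool, |∑ S ∈ 𝒮, a S * character S y| := by
  obtain ⟨h2, h4⟩ := sum_moments_of_private 𝒮 a c hc hc'
  set A := ∑ S ∈ 𝒮, a S ^ 2 with hA
  have hA0 : 0 ≤ A := Finset.sum_nonneg fun _ _ => sq_nonneg _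
  set s := √(2 * d) with hs
  have hs0 : 0 < s := Real.sqrt_pos.mpr (by linarith)
  have hs2 : s ^ 2 = 2 * d := Real.sq_sqrt (by linarith)
  have hpt : ∀ t : ℝ, (3 * s ^ 2 * t ^ 2 - t ^ 4) / (2 * s ^ 3) ≤ |t| := fun t => by
    rw [div_le_iff₀ (by positivity)]
    have h1 : 0 ≤ |t| * (|t| - s) ^ 2 * (|t| + 2 * s) := by positivity
    have h3 : t ^ 2 = |t| ^ 2 := (sq_abs t).symm
    have h5 : t ^ 4 = |t| ^ 4 := by rw [show t ^ 4 = (t ^ 2) ^ 2 by ring, h3]; ring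
    rw [h3, h5]
    nlinarith
  have hsum : (3 * s ^ 2 * (2 ^ n * A) - 2 ^ n * (3 * A ^ 2)) / (2 * s ^ 3) ≤
      ∑ y : Fin n → Bool, |∑ S ∈ 𝒮, a S * character S y| := by
    refine le_trans ?_ (Finset.sum_le_sum fun y _ => hpt _)
    rw [← Finset.sum_div, Finset.sum_sub_distrib, ← Finset.mul_sum, h2]
    gcongr
  refine le_trans ?_ hsum
  have hsd : s = √2 * √d := Real.sqrt_mul (by norm_num) d
  have hq : 0 < √d := Real.sqrt_pos.mpr hd
  have hsle : s ≤ 3 / 2 * √d := by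
    rw [hsd]
    gcongr
    rw [Real.sqrt_le_left (by norm_num)]
    norm_num
  rw [le_div_iff₀ (by positivity)]
  have hp : (0 : ℝ) < 2 ^ n := by positivity
  have e1 : 2 ^ n * (1 / 2 * (A / √d)) * (2 * s ^ 3) = 2 ^ n * (A * (2 * d) * (s / √d)) := by
    rw [← hs2]; ring
  have e2 : s / √d ≤ 3 / 2 := by rw [div_le_iff₀ hq]; exact hsle
  rw [e1, hs2]
  have e3 : A * (2 * d) * (s / √d) ≤ A * (2 * d) * (3 / 2) := by gcongr
  have e4 : A * A ≤ A * d := by gcongr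
  nlinarith

/-! ### The greedy choice on a triangle-free hypergraph -/

/-- Otherwise every vertex of `R` lies in a second hyperedge through `i`; two such hyperedges that
differ form a triangle with `R`, and a single one contains `R`, which has the maximal size. -/
theorem exists_private_vertex {n k : ℕ} {E : Finset (Finset (Fin n))}
    (hcard : ∀ R ∈ E, R.card ≤ k) (htri : HypergraphTriangleFree E) {R : Finset (Fin n)}
    (hR : R ∈ E) (hRk : R.card = k) {i : Fin n} (hi : i ∈ R) :
    ∃ c ∈ R, (2 ≤ k → c ≠ i) ∧ ∀ R' ∈ E, i ∈ R' → c ∈ R' → R' = R := by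
  have heq : ∀ R' ∈ E, R ⊆ R' → R' = R := fun R' hR' hsub =>
    (Finset.eq_of_subset_of_card_le hsub (by rw [hRk]; exact hcard R' hR')).symm
  by_cases hk : 2 ≤ k
  · by_contra! hcon
    have hcon' : ∀ c ∈ R, c ≠ i → ∃ R' ∈ E, i ∈ R' ∧ c ∈ R' ∧ R' ≠ R := fun c hc hci =>
      hcon c hc fun _ => hci
    obtain ⟨a, ha, hai⟩ : ∃ a ∈ R, a ≠ i :=
      Finset.exists_mem_ne (by omega) i
    obtain ⟨R₁, hR₁, hi₁, ha₁, hne₁⟩ := hcon' a ha hai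
    refine hne₁ (heq R₁ hR₁ fun b hb => ?_)
    by_contra hb₁
    have hbi : b ≠ i := fun h => hb₁ (h ▸ hi₁)
    have hba : b ≠ a := fun h => hb₁ (h ▸ ha₁)
    obtain ⟨R₂, hR₂, hi₂, hb₂, hne₂⟩ := hcon' b hb hbi
    exact htri R hR R₁ hR₁ R₂ hR₂ hne₁.symm (fun h => hb₁ (h ▸ hb₂)) hne₂.symm
      a b i hba.symm hai.symm hbi.symm ⟨⟨ha, hb⟩, ⟨hi₁, ha₁⟩, hi₂, hb₂⟩
  · have hRi : R = {i} := by
      symm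
      apply Finset.eq_of_subset_of_card_le (by simpa using hi)
      rw [hRk, Finset.card_singleton]
      omega
    refine ⟨i, hi, fun h => absurd h hk, fun R' hR' hi' _ => heq R' hR' ?_⟩
    rw [hRi]
    simpa using hi'

/-- The sets of size `k` that meet `U` in the vertex `i` only. -/
def activeSets {n : ℕ} (k : ℕ) (U : Finset (Fin n)) (i : Fin n) : Finset (Finset (Fin n)) :=
  Finset.univ.filter fun S => S.card = k ∧ S ∩ U = {i}

/-- The coefficient of the sign of vertex `i` in the active terms of the polynomial
`∑ S, a S * character S`. -/
def localField {n : ℕ} (a : Finset (Fin n) → ℝ) (k : ℕ) (U : Finset (Fin n)) (i : Fin n)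
    (y : Fin n → Bool) : ℝ :=
  ∑ S ∈ activeSets k U i, a S * character (S.erase i) y

/-- The greedy choice: a vertex opposes its local field, and keeps its coin if there is none. For
`i ∉ U` the local field is an empty sum. -/
noncomputable def greedyCoins {n : ℕ} (a : Finset (Fin n) → ℝ) (k : ℕ) (U : Finset (Fin n))
    (y : Fin n → Bool) : Fin n → Bool := fun i =>
  if 0 < localField a k U i y then true else if localField a k U i y < 0 then false else y i

theorem mem_activeSets {n k : ℕ} {U : Finset (Fin n)} {i : Fin n} {S : Finset (Fin n)} :
    S ∈ activeSets k U i ↔ S.card = k ∧ S ∩ U = {i} := by simp [activeSets]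

theorem mem_of_inter_eq_singleton {n : ℕ} {S U : Finset (Fin n)} {i : Fin n} (h : S ∩ U = {i}) :
    i ∈ S ∧ i ∈ U := by
  have : i ∈ S ∩ U := by simp [h]
  simpa using this

theorem greedyCoins_of_notMem {n k : ℕ} {a : Finset (Fin n) → ℝ} {U : Finset (Fin n)} {i : Fin n}
    (hi : i ∉ U) (y : Fin n → Bool) : greedyCoins a k U y i = y i := by
  have h : activeSets k U i = ∅ := by
    ext S
    simp only [mem_activeSets, Finset.notMem_empty, iff_false]
    exact fun h => hi (mem_of_inter_eq_singleton h.2).2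
  simp [greedyCoins, localField, h]

theorem coinSign_greedyCoins_mul {n k : ℕ} (a : Finset (Fin n) → ℝ) (U : Finset (Fin n))
    (i : Fin n) (y : Fin n → Bool) :
    coinSign (greedyCoins a k U y i) * localField a k U i y = -|localField a k U i y| := by
  unfold greedyCoins
  split_ifs with h1 h2
  · simp [coinSign, abs_of_pos h1]
  · simp [coinSign, abs_of_neg h2]
  · have : localField a k U i y = 0 := by linarith
    simp [this]

theorem greedyCoins_flip_of_neg {n k : ℕ} {a : Finset (Fin n) → ℝ} {U W : Finset (Fin n)}
    {i : Fin n} {y : Fin n → Bool}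
    (hg : localField a k U i (flipCoins W y) = -localField a k U i y) (hi : i ∈ W) :
    coinSign (greedyCoins a k U (flipCoins W y) i) = -coinSign (greedyCoins a k U y i) := by
  rw [← coinSign_not]
  congr 1
  unfold greedyCoins
  rw [hg]
  rcases lt_trichotomy (localField a k U i y) 0 with h | h | h
  · simp [h, h.not_gt]
  · simp [h, flipCoins, hi]
  · simp [h, h.not_gt]

theorem greedyCoins_flip_of_eq {n k : ℕ} {a : Finset (Fin n) → ℝ} {U W : Finset (Fin n)}
    {i : Fin n} {y : Fin n → Bool}
    (hg : localField a k U i (flipCoins W y) = localField a k U i y) (hi : i ∉ W) :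
    greedyCoins a k U (flipCoins W y) i = greedyCoins a k U y i := by
  unfold greedyCoins
  rw [hg]
  simp [flipCoins, hi]

theorem character_greedyCoins_erase {n k : ℕ} (a : Finset (Fin n) → ℝ) (U : Finset (Fin n))
    {S : Finset (Fin n)} {i : Fin n} (hS : S ∩ U = {i}) (y : Fin n → Bool) :
    character S (greedyCoins a k U y) =
      coinSign (greedyCoins a k U y i) * character (S.erase i) y := by
  rw [character, ← Finset.mul_prod_erase S _ (mem_of_inter_eq_singleton hS).1, character]
  congr 1
  refine Finset.prod_congr rfl fun j hj => ?_
  rw [greedyCoins_of_notMem]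
  intro hjU
  have : j ∈ S ∩ U := Finset.mem_inter.mpr ⟨Finset.mem_of_mem_erase hj, hjU⟩
  rw [hS, Finset.mem_singleton] at this
  exact Finset.ne_of_mem_erase hj this

section Vanishing

variable {n k : ℕ} {E : Finset (Finset (Fin n))} {a : Finset (Fin n) → ℝ} {U : Finset (Fin n)}

theorem mem_edges_of_card_eq (hcard : ∀ R ∈ E, R.card ≤ k)
    (ha : ∀ S, a S ≠ 0 → ∃ R ∈ E, S ⊆ R) {S : Finset (Fin n)} (hS : S.card = k) (hS0 : a S ≠ 0) :
    S ∈ E := by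
  obtain ⟨R, hR, hsub⟩ := ha S hS0
  rwa [Finset.eq_of_subset_of_card_le hsub (by rw [hS]; exact hcard R hR)]

/-- Flipping one private vertex of each hyperedge that is active at `i` negates the local field of
`i`, and with the coin of `i` flipped too the greedy choice at `i`, whereas it does not touch any
other part of a monomial inside a hyperedge `R₀` at `i` that is not active itself, because the
hypergraph has no triangles. -/
theorem sum_character_greedyCoins_eq_zero_of_notMem (hcard : ∀ R ∈ E, R.card ≤ k)
    (htri : HypergraphTriangleFree E) (ha : ∀ S, a S ≠ 0 → ∃ R ∈ E, S ⊆ R)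
    {S R₀ : Finset (Fin n)} {i : Fin n} {c : Finset (Fin n) → Fin n}
    (hc : ∀ R ∈ E, R ∈ activeSets k U i →
      c R ∈ R ∧ c R ≠ i ∧ ∀ R' ∈ E, i ∈ R' → c R ∈ R' → R' = R)
    (hR₀ : R₀ ∈ E) (hSR : S ⊆ R₀) (hiS : i ∈ S) (hiU : i ∈ U)
    (hS : ∀ R ∈ E, R ∈ activeSets k U i → c R ∉ S) :
    ∑ y, character S (greedyCoins a k U y) = 0 := by
  set A := E.filter fun R => R ∈ activeSets k U i with hA
  have hAE : ∀ R ∈ A, R ∈ E ∧ R ∈ activeSets k U i := fun R hR => by simpa [hA] using hR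
  set W := insert i (A.image c) with hW
  have hmemW : ∀ j, j ∈ W ↔ j = i ∨ ∃ R ∈ A, c R = j := fun j => by simp [hW]
  have hcU : ∀ R ∈ A, c R ∉ U := fun R hR hmem => by
    obtain ⟨hRE, hRa⟩ := hAE R hR
    have : c R ∈ R ∩ U := Finset.mem_inter.mpr ⟨(hc R hRE hRa).1, hmem⟩
    rw [(mem_activeSets.mp hRa).2, Finset.mem_singleton] at this
    exact (hc R hRE hRa).2.1 this
  have hgi : ∀ y, localField a k U i (flipCoins W y) = -localField a k U i y := fun y => by
    rw [localField, localField, ← Finset.sum_neg_distrib]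
    refine Finset.sum_congr rfl fun R hRa => ?_
    by_cases hR0 : a R = 0
    · simp [hR0]
    have hRE := mem_edges_of_card_eq hcard ha (mem_activeSets.mp hRa).1 hR0
    have hRA : R ∈ A := by simp [hA, hRE, hRa]
    rw [character_flipCoins_of_inter_eq_singleton (c := c R)]
    · ring
    ext j
    simp only [Finset.mem_inter, Finset.mem_erase, hmemW, Finset.mem_singleton]
    constructor
    · rintro ⟨⟨hji, hjR⟩, h | ⟨R', hR', rfl⟩⟩
      · exact absurd h hji
      · obtain ⟨hR'E, hR'a⟩ := hAE R' hR'
        rw [(hc R' hR'E hR'a).2.2 R hRE (mem_of_inter_eq_singleton (mem_activeSets.mp hRa).2).1 hjR]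
    · rintro rfl
      exact ⟨⟨(hc R hRE hRa).2.1, (hc R hRE hRa).1⟩, Or.inr ⟨R, hRA, rfl⟩⟩
  have hother : ∀ j ∈ S, j ≠ i → ∀ y,
      greedyCoins a k U (flipCoins W y) j = greedyCoins a k U y j := fun j hj hji y => by
    have hjW : j ∉ W := by
      rw [hmemW]
      rintro (h | ⟨R, hR, rfl⟩)
      · exact hji h
      · exact hS R (hAE R hR).1 (hAE R hR).2 hj
    by_cases hjU : j ∈ U
    · refine greedyCoins_flip_of_eq (Finset.sum_congr rfl fun R' hR'a => ?_) hjW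
      by_cases hR0 : a R' = 0
      · simp [hR0]
      have hR'E := mem_edges_of_card_eq hcard ha (mem_activeSets.mp hR'a).1 hR0
      have hR'U := (mem_activeSets.mp hR'a).2
      have hjR' := (mem_of_inter_eq_singleton hR'U).1
      have hiR' : i ∉ R' := fun h => hji (by
        have : i ∈ R' ∩ U := Finset.mem_inter.mpr ⟨h, hiU⟩
        rw [hR'U, Finset.mem_singleton] at this
        exact this.symm)
      rw [character_flipCoins_of_inter_eq_empty]
      rw [Finset.eq_empty_iff_forall_notMem]
      intro x hx
      simp only [Finset.mem_inter, Finset.mem_erase, hmemW] at hx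
      obtain ⟨⟨hxj, hxR'⟩, hxW⟩ := hx
      rcases hxW with rfl | ⟨R, hR, rfl⟩
      · exact hiR' hxR'
      -- `i`, `j` and the private vertex of `R` would form a triangle
      obtain ⟨hRE, hRa⟩ := hAE R hR
      have hRU := (mem_activeSets.mp hRa).2
      have hiR := (mem_of_inter_eq_singleton hRU).1
      have hjR : j ∉ R := fun h => hji (by
        have : j ∈ R ∩ U := Finset.mem_inter.mpr ⟨h, hjU⟩
        rwa [hRU, Finset.mem_singleton] at this)
      exact htri R₀ hR₀ R hRE R' hR'E (fun h => hjR (h ▸ hSR hj)) (fun h => hjR (h ▸ hjR'))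
        (fun h => hiR' (h ▸ hSR hiS)) i j (c R) hji.symm (hc R hRE hRa).2.1 hxj
        ⟨⟨hSR hiS, hSR hj⟩, ⟨(hc R hRE hRa).1, hiR⟩, hxR', hjR'⟩
    · rw [greedyCoins_of_notMem hjU, greedyCoins_of_notMem hjU]
      simp [flipCoins, hjW]
  refine sum_eq_zero_of_flip W _ fun y => ?_
  rw [character, character, ← Finset.mul_prod_erase S _ hiS, ← Finset.mul_prod_erase S _ hiS,
    greedyCoins_flip_of_neg (hgi y) (by simp [hW]), neg_mul]
  congr 2
  refine Finset.prod_congr rfl fun j hj => ?_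
  rw [hother j (Finset.mem_of_mem_erase hj) (Finset.ne_of_mem_erase hj)]

/-- If the monomial contains the private vertex of an active hyperedge `R`, without being all of
`R`, then its parity is independent of the monomials in the local field: a vertex `b` of `R`
outside the monomial is flipped together with the private vertices of the active hyperedges
through `b`. -/
theorem sum_character_greedyCoins_eq_zero_of_mem (hcard : ∀ R ∈ E, R.card ≤ k)
    (ha : ∀ S, a S ≠ 0 → ∃ R ∈ E, S ⊆ R)
    {S R : Finset (Fin n)} {i : Fin n} {c : Finset (Fin n) → Fin n}
    (hc : ∀ R ∈ E, R ∈ activeSets k U i →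
      c R ∈ R ∧ c R ≠ i ∧ ∀ R' ∈ E, i ∈ R' → c R ∈ R' → R' = R)
    (hRE : R ∈ E) (hRa : R ∈ activeSets k U i) (hSR : S ⊆ R) (hne : S ≠ R) (hSU : S ∩ U = {i})
    (hcS : c R ∈ S) :
    ∑ y, character S (greedyCoins a k U y) = 0 := by
  obtain ⟨hiS, hiU⟩ := mem_of_inter_eq_singleton hSU
  obtain ⟨b, hbR, hbS⟩ : ∃ b ∈ R, b ∉ S := by
    by_contra! h
    exact hne (Finset.Subset.antisymm hSR h)
  have hbi : b ≠ i := fun h => hbS (h ▸ hiS)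
  set A := E.filter fun R => R ∈ activeSets k U i ∧ b ∈ R with hA
  have hAE : ∀ R ∈ A, R ∈ E ∧ R ∈ activeSets k U i ∧ b ∈ R := fun R hR => by simpa [hA] using hR
  set W := insert b (A.image c) with hW
  have hmemW : ∀ j, j ∈ W ↔ j = b ∨ ∃ R ∈ A, c R = j := fun j => by simp [hW]
  have hiR : ∀ R' ∈ activeSets k U i, i ∈ R' := fun R' h =>
    (mem_of_inter_eq_singleton (mem_activeSets.mp h).2).1
  have hbc : ∀ R' ∈ E, R' ∈ activeSets k U i → c R' ≠ b := fun R' hR' hR'a h => by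
    have : R = R' := (hc R' hR' hR'a).2.2 R hRE (hiR R hRa) (h ▸ hbR)
    subst this
    exact hbS (h ▸ hcS)
  have hiW : i ∉ W := by
    rw [hmemW]
    rintro (h | ⟨R', hR', h⟩)
    · exact hbi h.symm
    · exact (hc R' (hAE R' hR').1 (hAE R' hR').2.1).2.1 h
  have hg : ∀ y, localField a k U i (flipCoins W y) = localField a k U i y := fun y => by
    refine Finset.sum_congr rfl fun R' hR'a => ?_
    by_cases hR0 : a R' = 0
    · simp [hR0]
    have hR'E := mem_edges_of_card_eq hcard ha (mem_activeSets.mp hR'a).1 hR0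
    by_cases hbR' : b ∈ R'
    · have hR'A : R' ∈ A := by simp [hA, hR'E, hR'a, hbR']
      have hint : R'.erase i ∩ W = {b, c R'} := by
        ext j
        simp only [Finset.mem_inter, Finset.mem_erase, hmemW, Finset.mem_insert,
          Finset.mem_singleton]
        constructor
        · rintro ⟨⟨-, hjR⟩, h | ⟨R'', hR'', rfl⟩⟩
          · exact Or.inl h
          · obtain ⟨hE, hact, -⟩ := hAE R'' hR''
            right
            rw [(hc R'' hE hact).2.2 R' hR'E (hiR R' hR'a) hjR]
        · rintro (rfl | rfl)
          · exact ⟨⟨hbi, hbR'⟩, Or.inl rfl⟩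
          · exact ⟨⟨(hc R' hR'E hR'a).2.1, (hc R' hR'E hR'a).1⟩, Or.inr ⟨R', hR'A, rfl⟩⟩
      rw [character_flipCoins, hint, Finset.card_pair (hbc R' hR'E hR'a).symm]
      ring
    · rw [character_flipCoins_of_inter_eq_empty]
      rw [Finset.eq_empty_iff_forall_notMem]
      intro x hx
      simp only [Finset.mem_inter, Finset.mem_erase, hmemW] at hx
      obtain ⟨⟨-, hxR'⟩, rfl | ⟨R'', hR'', rfl⟩⟩ := hx
      · exact hbR' hxR'
      · obtain ⟨hE, hact, hb⟩ := hAE R'' hR''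
        rw [(hc R'' hE hact).2.2 R' hR'E (hiR R' hR'a) hxR'] at hbR'
        exact hbR' hb
  have hint : S.erase i ∩ W = {c R} := by
    ext j
    simp only [Finset.mem_inter, Finset.mem_erase, hmemW, Finset.mem_singleton]
    constructor
    · rintro ⟨⟨-, hjS⟩, rfl | ⟨R'', hR'', rfl⟩⟩
      · exact absurd hjS hbS
      · obtain ⟨hE, hact, -⟩ := hAE R'' hR''
        rw [(hc R'' hE hact).2.2 R hRE (hiR R hRa) (hSR hjS)]
    · rintro rfl
      exact ⟨⟨(hc R hRE hRa).2.1, hcS⟩, Or.inr ⟨R, by simp [hA, hRE, hRa, hbR], rfl⟩⟩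
  refine sum_eq_zero_of_flip W _ fun y => ?_
  rw [character_greedyCoins_erase a U hSU, character_greedyCoins_erase a U hSU,
    greedyCoins_flip_of_eq (hg y) hiW, character_flipCoins_of_inter_eq_singleton hint, mul_neg]

/-- At the greedy point, all monomials but the constant and the active ones average out. -/
theorem sum_character_greedyCoins_eq_zero (hcard : ∀ R ∈ E, R.card ≤ k)
    (htri : HypergraphTriangleFree E) (ha : ∀ S, a S ≠ 0 → ∃ R ∈ E, S ⊆ R)
    {S : Finset (Fin n)} (hS0 : a S ≠ 0) (hSne : S.Nonempty) (hS : ∀ i, S ∉ activeSets k U i) :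
    ∑ y, character S (greedyCoins a k U y) = 0 := by
  obtain ⟨R₀, hR₀, hSR⟩ := ha S hS0
  rcases (S ∩ U).eq_empty_or_nonempty with hSU | ⟨i, hi⟩
  · rw [← sum_character_eq_zero hSne]
    refine Finset.sum_congr rfl fun y _ => Finset.prod_congr rfl fun j hj => ?_
    rw [greedyCoins_of_notMem]
    exact fun hjU => Finset.notMem_empty j (hSU ▸ Finset.mem_inter.mpr ⟨hj, hjU⟩)
  obtain ⟨hiS, hiU⟩ := Finset.mem_inter.mp hi
  -- a single vertex is active for `k = 1`
  have hk : 2 ≤ k := by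
    by_contra hk
    have hSi : S = {i} := by
      symm
      apply Finset.eq_of_subset_of_card_le (by simpa using hiS)
      have := (Finset.card_le_card hSR).trans (hcard R₀ hR₀)
      rw [Finset.card_singleton]
      omega
    apply hS i
    rw [mem_activeSets, hSi, Finset.singleton_inter_of_mem hiU, Finset.card_singleton]
    refine ⟨?_, rfl⟩
    have := (Finset.card_pos.mpr ⟨i, hSR hiS⟩).trans_le (hcard R₀ hR₀)
    omega
  have hex : ∀ R, ∃ x, R ∈ E → R ∈ activeSets k U i →
      x ∈ R ∧ x ≠ i ∧ ∀ R' ∈ E, i ∈ R' → x ∈ R' → R' = R := fun R => by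
    by_cases h : R ∈ E ∧ R ∈ activeSets k U i
    · obtain ⟨hRk, hRU⟩ := mem_activeSets.mp h.2
      obtain ⟨x, hx, hxi, hx'⟩ := exists_private_vertex hcard htri h.1 hRk
        (mem_of_inter_eq_singleton hRU).1
      exact ⟨x, fun _ _ => ⟨hx, hxi hk, hx'⟩⟩
    · exact ⟨i, fun h1 h2 => absurd ⟨h1, h2⟩ h⟩
  choose c hc using hex
  by_cases hcase : ∃ R ∈ E, R ∈ activeSets k U i ∧ c R ∈ S
  · obtain ⟨R, hRE, hRa, hcS⟩ := hcase
    have hRR : R₀ = R := (hc R hRE hRa).2.2 R₀ hR₀ (hSR hiS) (hSR hcS)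
    subst hRR
    have hSU : S ∩ U = {i} := by
      apply Finset.Subset.antisymm
      · rw [← (mem_activeSets.mp hRa).2]
        exact Finset.inter_subset_inter_right hSR
      · simpa using ⟨hiS, hiU⟩
    exact sum_character_greedyCoins_eq_zero_of_mem hcard ha hc hR₀ hRa hSR
      (fun h => hS i (h ▸ hRa)) hSU hcS
  · push Not at hcase
    exact sum_character_greedyCoins_eq_zero_of_notMem hcard htri ha hc hR₀ hSR hiS hiU hcase

/-- The mean value of the polynomial at the greedy point. -/
theorem sum_polynomial_greedyCoins (hcard : ∀ R ∈ E, R.card ≤ k)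
    (htri : HypergraphTriangleFree E) (ha : ∀ S, a S ≠ 0 → ∃ R ∈ E, S ⊆ R) :
    ∑ y, ∑ S, a S * character S (greedyCoins a k U y) =
      2 ^ n * a ∅ - ∑ i, ∑ y, |localField a k U i y| := by
  have hterm : ∀ S, ∑ y, a S * character S (greedyCoins a k U y) =
      (if S = ∅ then 2 ^ n * a ∅ else 0) +
        ∑ i, if S ∈ activeSets k U i then ∑ y, a S * character S (greedyCoins a k U y) else 0 := by
    intro S
    by_cases hact : ∃ i, S ∈ activeSets k U i
    · obtain ⟨i, hi⟩ := hact
      have hi' := mem_activeSets.mp hi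
      have hne : S ≠ ∅ := Finset.ne_empty_of_mem (mem_of_inter_eq_singleton hi'.2).1
      rw [if_neg hne, zero_add, Finset.sum_eq_single i, if_pos hi]
      · intro j _ hji
        rw [if_neg]
        intro hj
        have := hi'.2.symm.trans (mem_activeSets.mp hj).2
        exact hji (Finset.singleton_inj.mp this).symm
      · simp
    · push Not at hact
      rw [Finset.sum_eq_zero fun i _ => if_neg (hact i), add_zero]
      by_cases hS : S = ∅
      · simp [hS, character]
      rw [if_neg hS, ← Finset.mul_sum]
      by_cases hS0 : a S = 0
      · simp [hS0]
      rw [sum_character_greedyCoins_eq_zero hcard htri ha hS0 (Finset.nonempty_of_ne_empty hS) hact,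
        mul_zero]
  rw [Finset.sum_comm, Finset.sum_congr rfl fun S _ => hterm S, Finset.sum_add_distrib,
    Finset.sum_ite_eq' Finset.univ ∅, if_pos (Finset.mem_univ _), sub_eq_add_neg,
    ← Finset.sum_neg_distrib, Finset.sum_comm]
  congr 1
  refine Finset.sum_congr rfl fun i _ => ?_
  rw [← Finset.sum_filter, Finset.sum_comm, ← Finset.sum_neg_distrib]
  refine Finset.sum_congr rfl fun y _ => ?_
  rw [← coinSign_greedyCoins_mul, localField, Finset.mul_sum]
  refine Finset.sum_congr (by ext; simp) fun S hS => ?_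
  rw [character_greedyCoins_erase a U (mem_activeSets.mp (by simpa using hS)).2]
  ring

end Vanishing

/-- The mean absolute value of a local field. The local field is multiplied by the coin of its
vertex, so that its monomials become the parities of the active hyperedges themselves. -/
theorem le_sum_abs_localField {n k d : ℕ} {E : Finset (Finset (Fin n))}
    {a : Finset (Fin n) → ℝ} (U : Finset (Fin n)) (hcard : ∀ R ∈ E, R.card ≤ k)
    (htri : HypergraphTriangleFree E) (ha : ∀ S, a S ≠ 0 → ∃ R ∈ E, S ⊆ R)
    (ha1 : ∀ S, S.card = k → |a S| ≤ 1) (i : Fin n)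
    (hd : (E.filter fun R => i ∈ R).card ≤ d) :
    2 ^ n * (1 / 2 * ((∑ S ∈ activeSets k U i, a S ^ 2) / √(d : ℝ))) ≤
      ∑ y, |localField a k U i y| := by
  set 𝒮 := E.filter fun R => R ∈ activeSets k U i with h𝒮
  have hmem : ∀ S, S ∈ 𝒮 ↔ S ∈ E ∧ S ∈ activeSets k U i := fun S => by simp [h𝒮]
  have hiS : ∀ S ∈ activeSets k U i, i ∈ S := fun S hS =>
    (mem_of_inter_eq_singleton (mem_activeSets.mp hS).2).1
  have hsub : 𝒮 ⊆ activeSets k U i := fun S hS => ((hmem S).mp hS).2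
  have h0 : ∀ S ∈ activeSets k U i, S ∉ 𝒮 → a S = 0 := fun S hS hn => by
    by_contra hne
    exact hn ((hmem S).mpr
      ⟨mem_edges_of_card_eq hcard ha (mem_activeSets.mp hS).1 hne, hS⟩)
  have hsq : ∑ S ∈ activeSets k U i, a S ^ 2 = ∑ S ∈ 𝒮, a S ^ 2 :=
    (Finset.sum_subset hsub fun S hS hn => by simp [h0 S hS hn]).symm
  have habs : ∀ y, |localField a k U i y| = |∑ S ∈ 𝒮, a S * character S y| := fun y => by
    have h1 : coinSign (y i) * localField a k U i y = ∑ S ∈ 𝒮, a S * character S y := by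
      rw [localField, ← Finset.sum_subset hsub fun S hS hn => by simp [h0 S hS hn], Finset.mul_sum]
      refine Finset.sum_congr rfl fun S hS => ?_
      rw [character, character, ← Finset.mul_prod_erase S _ (hiS S (hsub hS))]
      ring
    rw [← h1, abs_mul]
    rcases coinSign_eq_or (y i) with h | h <;> simp [h]
  have hAd : ∑ S ∈ 𝒮, a S ^ 2 ≤ d := by
    calc ∑ S ∈ 𝒮, a S ^ 2 ≤ ∑ S ∈ 𝒮, (1 : ℝ) := Finset.sum_le_sum fun S hS => by
          have := ha1 S (mem_activeSets.mp (hsub hS)).1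
          rw [← sq_abs]
          exact pow_le_one₀ (abs_nonneg _) this
      _ = 𝒮.card := by simp
      _ ≤ d := by
          refine Nat.cast_le.mpr ((Finset.card_le_card fun S hS => ?_).trans hd)
          rw [Finset.mem_filter]
          exact ⟨((hmem S).mp hS).1, hiS S (hsub hS)⟩
  simp only [habs, hsq]
  rcases Nat.eq_zero_or_pos d with rfl | hd0
  · simp only [CharP.cast_eq_zero, Real.sqrt_zero, div_zero, mul_zero]
    exact Finset.sum_nonneg fun _ _ => abs_nonneg _
  have hex : ∀ R, ∃ x, R ∈ 𝒮 → x ∈ R ∧ ∀ R' ∈ E, i ∈ R' → x ∈ R' → R' = R := fun R => by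
    by_cases h : R ∈ 𝒮
    · obtain ⟨hRE, hRa⟩ := (hmem R).mp h
      obtain ⟨x, hx, -, hx'⟩ := exists_private_vertex hcard htri hRE (mem_activeSets.mp hRa).1
        (hiS R hRa)
      exact ⟨x, fun _ => ⟨hx, hx'⟩⟩
    · exact ⟨i, fun h1 => absurd h1 h⟩
  choose c hc using hex
  exact le_sum_abs_of_private 𝒮 a c (fun S hS => (hc S hS).1)
    (fun S hS S' hS' => (hc S hS).2 S' ((hmem S').mp hS').1 (hiS S' (hsub hS')))
    d (by exact_mod_cast hd0) hAd

/-! ### The program -/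

namespace RealRAM

/-- `c`, started in `s`, halts within time `T` in a state satisfying `Q`. -/
def Runs (ω : ℕ → Bool) (c : Cmd) (s : State) (T : ℕ) (Q : State → Prop) : Prop :=
  ∃ t ≤ T, ∃ s', Exec ω c s t s' ∧ Q s'

/-- Programs without loops. -/
def Cmd.LoopFree : Cmd → Prop
  | .seq c₁ c₂ => c₁.LoopFree ∧ c₂.LoopFree
  | .ite _ c₁ c₂ => c₁.LoopFree ∧ c₂.LoopFree
  | .loop _ _ => False
  | _ => True

/-- A time bound for programs without loops; a loop gets the junk value `0`. -/
def Cmd.cost : Cmd → ℕ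
  | .seq c₁ c₂ => c₁.cost + c₂.cost
  | .ite _ c₁ c₂ => c₁.cost + c₂.cost + 1
  | .loop _ _ => 0
  | _ => 1

open Classical in
/-- The final state of a program without loops; a loop is skipped. -/
noncomputable def Cmd.run (ω : ℕ → Bool) : Cmd → State → State
  | .skip, s => s
  | .setNat a e val, s => s.setNat a (e.eval s) (val.eval s)
  | .setReal a e val, s => s.setReal a (e.eval s) (val.eval s)
  | .toss a e, s => { s.setNat a (e.eval s) (ω s.coins).toNat with coins := s.coins + 1 }
  | .seq c₁ c₂, s => c₂.run ω (c₁.run ω s)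
  | .ite b c₁ c₂, s => if b.Holds s then c₁.run ω s else c₂.run ω s
  | .loop _ _, s => s

theorem Cmd.LoopFree.exec {ω : ℕ → Bool} {c : Cmd} (hc : c.LoopFree) (s : State) :
    ∃ t ≤ c.cost, Exec ω c s t (c.run ω s) := by
  induction c generalizing s with
  | skip => exact ⟨1, le_rfl, .skip s⟩
  | setNat a e v => exact ⟨1, le_rfl, .setNat a e v s⟩
  | setReal a e v => exact ⟨1, le_rfl, .setReal a e v s⟩
  | toss a e => exact ⟨1, le_rfl, .toss a e s⟩
  | seq c₁ c₂ ih₁ ih₂ =>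
    obtain ⟨t₁, ht₁, h₁⟩ := ih₁ hc.1 s
    obtain ⟨t₂, ht₂, h₂⟩ := ih₂ hc.2 (c₁.run ω s)
    exact ⟨t₁ + t₂, Nat.add_le_add ht₁ ht₂, .seq h₁ h₂⟩
  | ite b c₁ c₂ ih₁ ih₂ =>
    by_cases hb : b.Holds s
    · obtain ⟨t, ht, h⟩ := ih₁ hc.1 s
      refine ⟨t + 1, by simp only [cost]; omega, ?_⟩
      simpa [run, hb] using Exec.ite_true (c₂ := c₂) hb h
    · obtain ⟨t, ht, h⟩ := ih₂ hc.2 s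
      refine ⟨t + 1, by simp only [cost]; omega, ?_⟩
      simpa [run, hb] using Exec.ite_false (c₁ := c₁) hb h
  | loop b c => exact hc.elim

theorem Runs.of_loopFree {ω : ℕ → Bool} {c : Cmd} (hc : c.LoopFree) {s : State}
    {Q : State → Prop} (hQ : Q (c.run ω s)) : Runs ω c s c.cost Q := by
  obtain ⟨t, ht, h⟩ := hc.exec s
  exact ⟨t, ht, _, h, hQ⟩

theorem Runs.seq {ω : ℕ → Bool} {c₁ c₂ : Cmd} {s : State} {T₁ T₂ : ℕ} {Q₁ Q₂ : State → Prop}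
    (h₁ : Runs ω c₁ s T₁ Q₁) (h₂ : ∀ s', Q₁ s' → Runs ω c₂ s' T₂ Q₂) :
    Runs ω (.seq c₁ c₂) s (T₁ + T₂) Q₂ := by
  obtain ⟨t₁, ht₁, s₁, he₁, hQ₁⟩ := h₁
  obtain ⟨t₂, ht₂, s₂, he₂, hQ₂⟩ := h₂ s₁ hQ₁
  exact ⟨t₁ + t₂, Nat.add_le_add ht₁ ht₂, s₂, .seq he₁ he₂, hQ₂⟩

theorem Runs.mono {ω : ℕ → Bool} {c : Cmd} {s : State} {T T' : ℕ} {Q Q' : State → Prop}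
    (h : Runs ω c s T Q) (hT : T ≤ T') (hQ : ∀ s', Q s' → Q' s') : Runs ω c s T' Q' := by
  obtain ⟨t, ht, s', he, hs'⟩ := h
  exact ⟨t, ht.trans hT, s', he, hQ s' hs'⟩

/-- A loop that is passed `N` times, with an invariant indexed by the number of passes. -/
theorem Runs.loop {ω : ℕ → Bool} {b : Test} {c : Cmd} {N τ : ℕ} {I : ℕ → State → Prop}
    (hb : ∀ j ≤ N, ∀ s, I j s → (b.Holds s ↔ j < N))
    (hc : ∀ j < N, ∀ s, I j s → Runs ω c s τ (I (j + 1))) {s : State} (hs : I 0 s) :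
    Runs ω (.loop b c) s (N * (τ + 1) + 1) (I N) := by
  suffices h : ∀ m ≤ N, ∀ s, I (N - m) s → Runs ω (.loop b c) s (m * (τ + 1) + 1) (I N) from
    h N le_rfl s (by simpa using hs)
  intro m
  induction m with
  | zero =>
    intro _ s hs
    exact ⟨1, by simp, s, .loop_done (by rw [hb (N - 0) (by omega) s hs]; omega), hs⟩
  | succ m ih =>
    intro hm s hs
    obtain ⟨t₁, ht₁, s₁, he₁, hs₁⟩ := hc (N - (m + 1)) (by omega) s hs
    rw [show N - (m + 1) + 1 = N - m by omega] at hs₁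
    obtain ⟨t₂, ht₂, s₂, he₂, hs₂⟩ := ih (by omega) s₁ hs₁
    refine ⟨t₁ + t₂ + 1, ?_, s₂, .loop_step ((hb _ (by omega) s hs).mpr (by omega)) he₁ he₂, hs₂⟩
    rw [Nat.succ_mul]
    omega

/-- The entry of index `0` of an integer array, used as a single variable. -/
def var (a : ℕ) : NatExpr := .get a (.const 0)

/-- Increase a variable by one. -/
def incr (a : ℕ) : Cmd := .setNat a (.const 0) (.add (var a) (.const 1))

/-- Set a variable to zero. -/
def clear (a : ℕ) : Cmd := .setNat a (.const 0) (.const 0)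

/-- Distance of integers, by truncated subtraction. -/
def absDiff (e₁ e₂ : NatExpr) : NatExpr := .add (.sub e₁ e₂) (.sub e₂ e₁)

/-- Toss the coins of the qubit with index in variable `2`: its letter, which is the entry of the
array `10`, its membership in the greedy set, in the array `12`, and its sign, in the array `13`. -/
def tossBody : Cmd :=
  .seq (.toss 10 (var 2)) <| .seq (.toss 11 (.const 0)) <|
  .seq (.setNat 10 (var 2) (.add (.const 1) (.add (.get 10 (var 2)) (var 11)))) <|
  .seq (.toss 12 (var 2)) <| .seq (.toss 13 (var 2)) (incr 2)

/-- Read the letter of the current word at the qubit with index in variable `2`; variable `4` points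
to the letter. Variable `5` measures the deviation from the letters of the chosen bases, `6`
counts the letters, `7` those in the greedy set, the last of which is remembered in `8`, and `9` is
the parity of the signs at the letters outside the greedy set. -/
def scanBody : Cmd :=
  .seq (.ite (.natLt (.const 0) (.get 1 (var 4)))
    (.seq (.setNat 5 (.const 0) (.add (var 5) (absDiff (.get 1 (var 4)) (.get 10 (var 2))))) <|
      .seq (incr 6) <|
      .ite (.natLt (.const 0) (.get 12 (var 2)))
        (.seq (incr 7) (.setNat 8 (.const 0) (var 2)))
        (.setNat 9 (.const 0) (absDiff (var 9) (.get 13 (var 2)))))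
    .skip) <|
  .seq (incr 4) (incr 2)

/-- Reset the variables used by `scanBody`. -/
def scanInit : Cmd :=
  .seq (clear 2) <| .seq (clear 5) <| .seq (clear 6) <| .seq (clear 7) <| .seq (clear 8) (clear 9)

/-- Add the current term to the local field, in the real array `2`, of its only vertex in the greedy
set, if the term is an active one. -/
def scanFinish : Cmd :=
  .seq (.ite (.natLt (.add (var 5) (.add (absDiff (var 6) (.get 0 (.const 1)))
      (absDiff (var 7) (.const 1)))) (.const 1))
    (.ite (.natLt (var 9) (.const 1))
      (.setReal 2 (var 8) (.add (.get 2 (var 8)) (.get 0 (var 3))))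
      (.setReal 2 (var 8) (.sub (.get 2 (var 8)) (.get 0 (var 3)))))
    .skip) (incr 3)

/-- Process the term with index in variable `3`. -/
def termBody : Cmd :=
  .seq scanInit <| .seq (.loop (.natLt (var 2) (.get 0 (.const 0))) scanBody) scanFinish

/-- Make the greedy choice at the qubit with index in variable `2` and write down its Bloch
vector. -/
def outputBody : Cmd :=
  .seq (.ite (.realLt .zero (.get 2 (var 2))) (.setNat 13 (var 2) (.const 1))
    (.ite (.realLt (.get 2 (var 2)) .zero) (.setNat 13 (var 2) (.const 0)) .skip)) <|
  .seq (.ite (.natLt (.get 13 (var 2)) (.const 1))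
    (.setReal 1 (.sub (.add (.add (var 2) (.add (var 2) (var 2))) (.get 10 (var 2))) (.const 1)) .one)
    (.setReal 1 (.sub (.add (.add (var 2) (.add (var 2) (var 2))) (.get 10 (var 2))) (.const 1))
      (.sub .zero .one))) (incr 2)

/-- The algorithm: toss the coins of every qubit, compute the local fields term by term, and write
down the Bloch vectors. -/
def greedyProgram : Cmd :=
  .seq (.loop (.natLt (var 2) (.get 0 (.const 0))) tossBody) <|
  .seq (.loop (.natLt (var 3) (.get 0 (.const 2))) termBody) <|
  .seq (clear 2) (.loop (.natLt (var 2) (.get 0 (.const 0))) outputBody)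

end RealRAM

/-- The letter of the basis of qubit `i`, from the coins `4 i` and `4 i + 1`. -/
def tapeLetter (ω : ℕ → Bool) (i : ℕ) : ℕ := 1 + ((ω (4 * i)).toNat + (ω (4 * i + 1)).toNat)

/-- The words of the input are stored one after the other. -/
theorem getD_flatMap_ofFn {n : ℕ} (L : List (ℝ × (Fin n → Fin 4))) (m : ℕ) (hm : m < L.length)
    (i : Fin n) :
    (L.flatMap fun q => List.ofFn fun i => (q.2 i : ℕ)).getD (m * n + i) 0 = (L[m].2 i : ℕ) := by
  induction L generalizing m with
  | nil => simp at hm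
  | cons q L ih =>
    rw [List.flatMap_cons]
    cases m with
    | zero =>
      rw [List.getD_append _ _ _ _ (by simp)]
      simp
    | succ m =>
      rw [List.getD_append_right _ _ _ _ (by simp; nlinarith)]
      simp only [List.length_ofFn, List.getElem_cons_succ]
      rw [← ih m (by simpa using hm)]
      congr 1
      rw [Nat.succ_mul]
      omega

/-! ### Verification of the program -/

open RealRAM

/-- The memory between the two loops over the qubits: the input, and the coins of all qubits. -/
structure Loaded {n : ℕ} (k : ℕ) (L : List (ℝ × (Fin n → Fin 4))) (B : Fin n → Fin 4)
    (U : Finset (Fin n)) (y : Fin n → Bool) (s : State) : Prop where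
  qubits : s.nat 0 0 = n
  locality : s.nat 0 1 = k
  terms : s.nat 0 2 = L.length
  letter : ∀ m (hm : m < L.length) (i : Fin n), s.nat 1 (m * n + i) = (L[m].2 i : ℕ)
  coeff : ∀ m (hm : m < L.length), s.real 0 m = L[m].1
  basis : ∀ i : Fin n, s.nat 10 i = B i
  greedy : ∀ i : Fin n, s.nat 12 i = if i ∈ U then 1 else 0
  sign : ∀ i : Fin n, s.nat 13 i = (y i).toNat
  output : ∀ j, s.real 1 j = 0

/-- The two states agree on everything that `Loaded` speaks of. -/
structure SameData (s s' : State) : Prop where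
  nat0 : s'.nat 0 = s.nat 0
  nat1 : s'.nat 1 = s.nat 1
  nat10 : s'.nat 10 = s.nat 10
  nat12 : s'.nat 12 = s.nat 12
  nat13 : s'.nat 13 = s.nat 13
  real0 : s'.real 0 = s.real 0
  real1 : s'.real 1 = s.real 1

theorem Loaded.congr {n k : ℕ} {L : List (ℝ × (Fin n → Fin 4))} {B : Fin n → Fin 4}
    {U : Finset (Fin n)} {y : Fin n → Bool} {s s' : State} (h : Loaded k L B U y s)
    (hs : SameData s s') : Loaded k L B U y s' where
  qubits := by rw [hs.nat0, h.qubits]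
  locality := by rw [hs.nat0, h.locality]
  terms := by rw [hs.nat0, h.terms]
  letter m hm i := by rw [hs.nat1, h.letter m hm i]
  coeff m hm := by rw [hs.real0, h.coeff m hm]
  basis i := by rw [hs.nat10, h.basis]
  greedy i := by rw [hs.nat12, h.greedy]
  sign i := by rw [hs.nat13, h.sign]
  output j := by rw [hs.real1, h.output]

/-- The invariant of the coin-tossing loop. -/
structure TossInv (ω : ℕ → Bool) (s₀ : State) (j : ℕ) (s : State) : Prop where
  coins : s.coins = 4 * j
  index : s.nat 2 0 = j
  letter : ∀ i < j, s.nat 10 i = tapeLetter ω i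
  greedy : ∀ i < j, s.nat 12 i = (ω (4 * i + 2)).toNat
  sign : ∀ i < j, s.nat 13 i = (ω (4 * i + 3)).toNat
  real : s.real = s₀.real
  low : s.nat 0 = s₀.nat 0 ∧ s.nat 1 = s₀.nat 1 ∧ s.nat 3 = s₀.nat 3 ∧ s.nat 4 = s₀.nat 4

theorem tossBody_spec {ω : ℕ → Bool} {s₀ s : State} {j : ℕ} (h : TossInv ω s₀ j s) :
    TossInv ω s₀ (j + 1) (tossBody.run ω s) := by
  obtain ⟨h1, h2, h3, h4, h5, h6, h7⟩ := h
  have hlt : ∀ i < j + 1, i = j ∨ (i ≠ j ∧ i < j) := fun i hi => by omega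
  constructor
  · simp [tossBody, incr, var, Cmd.run, State.setNat, NatExpr.eval, h1]; ring
  · simp [tossBody, incr, var, Cmd.run, State.setNat, NatExpr.eval, h2]
  · intro i hi
    rcases hlt i hi with rfl | ⟨hne, hlt⟩
    · simp [tossBody, incr, var, Cmd.run, State.setNat, NatExpr.eval, h1, h2, tapeLetter]
    · simp [tossBody, incr, var, Cmd.run, State.setNat, NatExpr.eval, h2, hne, h3 i hlt]
  · intro i hi
    rcases hlt i hi with rfl | ⟨hne, hlt⟩
    · simp [tossBody, incr, var, Cmd.run, State.setNat, NatExpr.eval, h1, h2]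
    · simp [tossBody, incr, var, Cmd.run, State.setNat, NatExpr.eval, h2, hne, h4 i hlt]
  · intro i hi
    rcases hlt i hi with rfl | ⟨hne, hlt⟩
    · simp [tossBody, incr, var, Cmd.run, State.setNat, NatExpr.eval, h1, h2]
    · simp [tossBody, incr, var, Cmd.run, State.setNat, NatExpr.eval, h2, hne, h5 i hlt]
  · simp [tossBody, incr, var, Cmd.run, State.setNat, h6]
  · simp [tossBody, incr, var, Cmd.run, State.setNat, h7]

/-- The positions below `i` at which a word has a letter, and a further property holds. -/
def lettersBelow {n : ℕ} (P : Fin n → Fin 4) (i : ℕ) (p : Fin n → Prop) [DecidablePred p] :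
    Finset (Fin n) :=
  Finset.univ.filter fun l => l.val < i ∧ P l ≠ 0 ∧ p l

theorem lettersBelow_succ_of_pos {n : ℕ} {P : Fin n → Fin 4} {i : Fin n} {p : Fin n → Prop}
    [DecidablePred p] (hP : P i ≠ 0) (hp : p i) :
    lettersBelow P (i + 1) p = insert i (lettersBelow P i p) := by
  ext l
  simp only [lettersBelow, Finset.mem_filter, Finset.mem_univ, true_and, Finset.mem_insert,
    Fin.ext_iff]
  by_cases hl : l = i
  · subst hl; simp [hP, hp]
  · have : l.val ≠ i.val := fun h => hl (Fin.ext h)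
    constructor
    · rintro ⟨h1, h2⟩; exact Or.inr ⟨by omega, h2⟩
    · rintro (h | ⟨h1, h2⟩)
      · exact absurd h this
      · exact ⟨by omega, h2⟩

theorem lettersBelow_succ_of_neg {n : ℕ} {P : Fin n → Fin 4} {i : Fin n} {p : Fin n → Prop}
    [DecidablePred p] (h : ¬ (P i ≠ 0 ∧ p i)) :
    lettersBelow P (i + 1) p = lettersBelow P i p := by
  ext l
  simp only [lettersBelow, Finset.mem_filter, Finset.mem_univ, true_and]
  by_cases hl : l = i
  · subst hl; simp only [h, and_false]
  · have : l.val ≠ i.val := fun h => hl (Fin.ext h)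
    constructor <;> rintro ⟨h1, h2⟩ <;> exact ⟨by omega, h2⟩

theorem notMem_lettersBelow {n : ℕ} {P : Fin n → Fin 4} {i : Fin n} {p : Fin n → Prop}
    [DecidablePred p] : i ∉ lettersBelow P i p := by
  simp [lettersBelow]

/-- The invariant of the scan of a word `P` whose letters start at position `base`. -/
structure ScanInv {n : ℕ} (P : Fin n → Fin 4) (B : Fin n → Fin 4) (U : Finset (Fin n))
    (y : Fin n → Bool) (base : ℕ) (s₀ : State) (i : ℕ) (s : State) : Prop where
  index : s.nat 2 0 = i
  pointer : s.nat 4 0 = base + i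
  deviation : s.nat 5 0 = 0 ↔ ∀ l : Fin n, l.val < i → P l ≠ 0 → P l = B l
  count : s.nat 6 0 = (lettersBelow P i fun _ => True).card
  countGreedy : s.nat 7 0 = (lettersBelow P i (· ∈ U)).card
  last : 0 < s.nat 7 0 → ∃ l ∈ lettersBelow P i (· ∈ U), s.nat 8 0 = l.val
  parity : ∃ b : Bool, s.nat 9 0 = b.toNat ∧
    coinSign b = character (lettersBelow P i (· ∉ U)) y
  same : SameData s₀ s
  term : s.nat 3 = s₀.nat 3
  field : s.real 2 = s₀.real 2

theorem scanBody_spec {n : ℕ} {ω : ℕ → Bool} {P : Fin n → Fin 4} {B : Fin n → Fin 4}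
    {U : Finset (Fin n)} {y : Fin n → Bool} {base : ℕ} {s₀ s : State} (i : Fin n)
    (hbase : s₀.nat 1 (base + i) = (P i : ℕ)) (hB : s₀.nat 10 i = (B i : ℕ))
    (hU : s₀.nat 12 i = if i ∈ U then 1 else 0) (hy : s₀.nat 13 i = (y i).toNat)
    (h : ScanInv P B U y base s₀ i s) : ScanInv P B U y base s₀ (i + 1) (scanBody.run ω s) := by
  obtain ⟨h2, h4, h5, h6, h7, h8, ⟨b, h9, hb⟩, ⟨e0, e1, e10, e12, e13, er0, er1⟩, h3, hr2⟩ := h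
  have hlt : ∀ l : Fin n, l.val < i.val + 1 ↔ l = i ∨ l.val < i.val := fun l => by
    rw [Fin.ext_iff]; omega
  have hall : (∀ l : Fin n, l.val < i.val + 1 → P l ≠ 0 → P l = B l) ↔
      (P i ≠ 0 → P i = B i) ∧ ∀ l : Fin n, l.val < i.val → P l ≠ 0 → P l = B l := by
    simp only [hlt, or_imp, forall_and, forall_eq]
  by_cases hP : P i = 0
  · have hnot : ∀ q : Prop, ¬ (P i ≠ 0 ∧ q) := fun q h => h.1 hP
    have hrun : scanBody.run ω s = (s.setNat 4 0 (base + i + 1)).setNat 2 0 (i + 1) := by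
      simp [scanBody, incr, var, Cmd.run, State.setNat, NatExpr.eval, Test.Holds, e1, h4, h2,
        hbase, hP]
    rw [hrun]
    constructor
    · simp [State.setNat]
    · simp [State.setNat, add_assoc]
    · rw [hall]
      simp [State.setNat, hP, h5]
    · rw [lettersBelow_succ_of_neg (hnot _)]
      simp [State.setNat, h6]
    · rw [lettersBelow_succ_of_neg (hnot _)]
      simp [State.setNat, h7]
    · rw [lettersBelow_succ_of_neg (hnot _)]
      simpa [State.setNat] using h8
    · rw [lettersBelow_succ_of_neg (hnot _)]
      exact ⟨b, by simp [State.setNat, h9], hb⟩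
    · constructor <;> simp [State.setNat, e0, e1, e10, e12, e13, er0, er1]
    · simp [State.setNat, h3]
    · simp [State.setNat, hr2]
  have hpos : 0 < (P i).val := Fin.pos_iff_ne_zero.mpr hP
  have hPB : P i = B i ↔ ((P i).val - (B i).val) + ((B i).val - (P i).val) = 0 := by
    rw [Fin.ext_iff]; omega
  by_cases hiU : i ∈ U
  · rw [if_pos hiU] at hU
    have hrun : scanBody.run ω s = (((((s.setNat 5 0
        (s.nat 5 0 + (((P i).val - (B i).val) + ((B i).val - (P i).val)))).setNat 6 0
        (s.nat 6 0 + 1)).setNat 7 0 (s.nat 7 0 + 1)).setNat 8 0 i).setNat 4 0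
        (base + i + 1)).setNat 2 0 (i + 1) := by
      simp [scanBody, incr, var, absDiff, Cmd.run, State.setNat, NatExpr.eval, Test.Holds, e1, e10,
        e12, h4, h2, hbase, hpos, hU, hB]
    rw [hrun]
    constructor
    · simp [State.setNat]
    · simp [State.setNat, add_assoc]
    · rw [hall, hPB, ← h5]
      simp [State.setNat, hP]
      tauto
    · rw [lettersBelow_succ_of_pos hP trivial, Finset.card_insert_of_notMem notMem_lettersBelow]
      simp [State.setNat, h6]
    · rw [lettersBelow_succ_of_pos hP hiU, Finset.card_insert_of_notMem notMem_lettersBelow]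
      simp [State.setNat, h7]
    · intro _
      rw [lettersBelow_succ_of_pos hP hiU]
      exact ⟨i, Finset.mem_insert_self _ _, by simp [State.setNat]⟩
    · rw [lettersBelow_succ_of_neg (by simp [hiU])]
      exact ⟨b, by simp [State.setNat, h9], hb⟩
    · constructor <;> simp [State.setNat, e0, e1, e10, e12, e13, er0, er1]
    · simp [State.setNat, h3]
    · simp [State.setNat, hr2]
  · rw [if_neg hiU] at hU
    have hxor : (b.toNat - (y i).toNat) + ((y i).toNat - b.toNat) = (xor b (y i)).toNat := by
      cases b <;> cases y i <;> rfl
    have hrun : scanBody.run ω s = ((((s.setNat 5 0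
        (s.nat 5 0 + (((P i).val - (B i).val) + ((B i).val - (P i).val)))).setNat 6 0
        (s.nat 6 0 + 1)).setNat 9 0 (xor b (y i)).toNat).setNat 4 0
        (base + i + 1)).setNat 2 0 (i + 1) := by
      simp [scanBody, incr, var, absDiff, Cmd.run, State.setNat, NatExpr.eval, Test.Holds, e1, e10,
        e12, e13, h4, h2, hbase, hpos, hU, hB, hy, h9, hxor]
    rw [hrun]
    constructor
    · simp [State.setNat]
    · simp [State.setNat, add_assoc]
    · rw [hall, hPB, ← h5]
      simp [State.setNat, hP]
      tauto
    · rw [lettersBelow_succ_of_pos hP trivial, Finset.card_insert_of_notMem notMem_lettersBelow]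
      simp [State.setNat, h6]
    · rw [lettersBelow_succ_of_neg (fun h => hiU h.2)]
      simp [State.setNat, h7]
    · rw [lettersBelow_succ_of_neg (fun h => hiU h.2)]
      simpa [State.setNat] using h8
    · rw [lettersBelow_succ_of_pos (p := (· ∉ U)) hP hiU]
      refine ⟨xor b (y i), by simp [State.setNat], ?_⟩
      rw [character, Finset.prod_insert notMem_lettersBelow, ← character, ← hb]
      cases b <;> cases y i <;> simp [coinSign]
    · constructor <;> simp [State.setNat, e0, e1, e10, e12, e13, er0, er1]
    · simp [State.setNat, h3]
    · simp [State.setNat, hr2]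

/-- A word whose term enters the local field of `i`: it has `k` letters, which agree with the
chosen bases, and `i` is its only letter in the greedy set. -/
def IsActiveWord {n : ℕ} (k : ℕ) (B : Fin n → Fin 4) (U : Finset (Fin n)) (P : Fin n → Fin 4)
    (i : Fin n) : Prop :=
  (pauliSupport P).card = k ∧ (∀ l, P l ≠ 0 → P l = B l) ∧ pauliSupport P ∩ U = {i}

open Classical in
/-- The factor with which the coefficient of a word enters the local field of `i`. -/
noncomputable def activeSign {n : ℕ} (k : ℕ) (B : Fin n → Fin 4) (U : Finset (Fin n))
    (y : Fin n → Bool) (i : Fin n) (P : Fin n → Fin 4) : ℝ :=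
  if IsActiveWord k B U P i then character ((pauliSupport P).erase i) y else 0

/-- The invariant of the loop over the terms: the real array `2` holds the local fields of the
first `m` terms. -/
structure FieldInv {n : ℕ} (k : ℕ) (L : List (ℝ × (Fin n → Fin 4))) (B : Fin n → Fin 4)
    (U : Finset (Fin n)) (y : Fin n → Bool) (m : ℕ) (s : State) : Prop where
  loaded : Loaded k L B U y s
  term : s.nat 3 0 = m
  pointer : s.nat 4 0 = m * n
  field : ∀ i : Fin n,
    s.real 2 i = ((L.take m).map fun q => q.1 * activeSign k B U y i q.2).sum

section Program

variable {n k : ℕ} {L : List (ℝ × (Fin n → Fin 4))} {B : Fin n → Fin 4} {U : Finset (Fin n)}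
  {y : Fin n → Bool} {ω : ℕ → Bool}

theorem lettersBelow_top (P : Fin n → Fin 4) (p : Fin n → Prop) [DecidablePred p] :
    lettersBelow P n p = (pauliSupport P).filter p := by
  ext l
  simp [lettersBelow, pauliSupport]

theorem scanFinish_spec {m : ℕ} (hm : m < L.length) {s₀ s : State}
    (h₀ : FieldInv k L B U y m s₀) (h : ScanInv L[m].2 B U y (m * n) s₀ n s) :
    FieldInv k L B U y (m + 1) (scanFinish.run ω s) := by
  set P := L[m].2 with hP
  obtain ⟨h2, h4, h5, h6, h7, h8, ⟨b, h9, hb⟩, hsame, h3, hr2⟩ := h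
  have hl := h₀.loaded.congr hsame
  rw [lettersBelow_top] at h6 h7 hb
  rw [Finset.filter_true] at h6
  have hfilter : (pauliSupport P).filter (· ∈ U) = pauliSupport P ∩ U := Finset.filter_mem_eq_inter
  rw [hfilter] at h7
  have hstep : ∀ i : Fin n, ((L.take (m + 1)).map fun q => q.1 * activeSign k B U y i q.2).sum =
      s.real 2 i + L[m].1 * activeSign k B U y i P := fun i => by
    rw [List.take_succ_eq_append_getElem hm, List.map_append, List.sum_append, ← h₀.field i, hr2]
    simp [hP]
  have hterm : s.nat 3 0 = m := by rw [h3, h₀.term]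
  have hk := hl.locality
  have hc := hl.coeff m hm
  have hptr : m * n + n = (m + 1) * n := by ring
  by_cases hact : s.nat 5 0 = 0 ∧ s.nat 6 0 = k ∧ s.nat 7 0 = 1
  · obtain ⟨a5, a6, a7⟩ := hact
    obtain ⟨l, hlU, hl8⟩ := h8 (by omega)
    rw [lettersBelow_top, hfilter] at hlU
    have hsingle : pauliSupport P ∩ U = {l} := by
      obtain ⟨x, hx⟩ := Finset.card_eq_one.mp (h7 ▸ a7)
      rw [hx, Finset.mem_singleton] at hlU
      rw [hx, hlU]
    have hactive : IsActiveWord k B U P l :=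
      ⟨by rw [← h6, a6], fun j => h5.mp a5 j j.isLt, hsingle⟩
    have hsign : ∀ i, activeSign k B U y i P = if i = l then coinSign b else 0 := fun i => by
      by_cases hi : i = l
      · subst hi
        rw [activeSign, if_pos hactive, if_pos rfl, hb]
        congr 1
        ext j
        have hj : j ∈ pauliSupport P ∩ U ↔ j = i := by rw [hsingle, Finset.mem_singleton]
        rw [Finset.mem_inter] at hj
        simp only [Finset.mem_erase, Finset.mem_filter]
        tauto
      · rw [activeSign, if_neg, if_neg hi]
        exact fun h => hi (Finset.singleton_inj.mp (h.2.2.symm.trans hsingle))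
    have hrun : scanFinish.run ω s =
        (s.setReal 2 l (s.real 2 l + L[m].1 * coinSign b)).setNat 3 0 (m + 1) := by
      cases b
      · simp [scanFinish, incr, var, absDiff, Cmd.run, State.setNat, State.setReal, NatExpr.eval,
          RealExpr.eval, Test.Holds, a5, a6, a7, hk, h9, hl8, hterm, hc, coinSign]
      · simp [scanFinish, incr, var, absDiff, Cmd.run, State.setNat, State.setReal, NatExpr.eval,
          RealExpr.eval, Test.Holds, a5, a6, a7, hk, h9, hl8, hterm, hc, coinSign, sub_eq_add_neg]
    rw [hrun]
    constructor
    · exact hl.congr (by constructor <;> simp [State.setNat, State.setReal])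
    · simp [State.setNat]
    · simp [State.setNat, State.setReal, h4, hptr]
    · intro i
      rw [hstep, hsign]
      by_cases hi : i = l
      · simp [State.setNat, State.setReal, hi]
      · have : (i : ℕ) ≠ l := fun h => hi (Fin.ext h)
        simp [State.setNat, State.setReal, hi, this]
  · have hsign : ∀ i, activeSign k B U y i P = 0 := fun i => by
      rw [activeSign, if_neg]
      rintro ⟨c1, c2, c3⟩
      exact hact ⟨h5.mpr fun j _ => c2 j, by rw [h6, c1], by rw [h7, c3, Finset.card_singleton]⟩
    have hguard : ¬ (s.nat 5 0 + (((s.nat 6 0 - k) + (k - s.nat 6 0)) +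
        ((s.nat 7 0 - 1) + (1 - s.nat 7 0))) < 1) := by omega
    have hrun : scanFinish.run ω s = s.setNat 3 0 (m + 1) := by
      simp only [scanFinish, incr, var, absDiff, Cmd.run, NatExpr.eval, Test.Holds, hk, hterm,
        if_neg hguard]
    rw [hrun]
    constructor
    · exact hl.congr (by constructor <;> simp [State.setNat])
    · simp [State.setNat]
    · simp [State.setNat, h4, hptr]
    · intro i
      rw [hstep, hsign]
      simp [State.setNat]

theorem scanInit_spec (P : Fin n → Fin 4) {m : ℕ} {s : State} (h : FieldInv k L B U y m s) :
    ScanInv P B U y (m * n) s 0 (scanInit.run ω s) := by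
  have h0 : ∀ (p : Fin n → Prop) [DecidablePred p], lettersBelow P 0 p = ∅ := fun p _ => by
    simp [lettersBelow]
  have hrun : scanInit.run ω s = (((((s.setNat 2 0 0).setNat 5 0 0).setNat 6 0 0).setNat 7 0
      0).setNat 8 0 0).setNat 9 0 0 := rfl
  rw [hrun]
  constructor
  · simp [State.setNat]
  · simp [State.setNat, h.pointer]
  · simp [State.setNat]
  · simp [State.setNat, h0]
  · simp [State.setNat, h0]
  · simp [State.setNat]
  · exact ⟨false, by simp [State.setNat], by simp [h0, coinSign, character]⟩
  · constructor <;> simp [State.setNat]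
  · simp [State.setNat]
  · simp [State.setNat]

theorem termBody_spec {m : ℕ} (hm : m < L.length) {s : State} (h : FieldInv k L B U y m s) :
    Runs ω termBody s (6 + ((n * (scanBody.cost + 1) + 1) + scanFinish.cost))
      (FieldInv k L B U y (m + 1)) := by
  refine Runs.seq (Q₁ := ScanInv L[m].2 B U y (m * n) s 0)
    (Runs.of_loopFree (by simp [scanInit, clear, Cmd.LoopFree]) (scanInit_spec _ h)) ?_
  intro s₁ hs₁
  refine Runs.seq (Q₁ := ScanInv L[m].2 B U y (m * n) s n) ?_ ?_
  · refine Runs.loop ?_ ?_ hs₁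
    · intro j _ s' hs'
      have : s'.nat 0 0 = n := by rw [hs'.same.nat0, h.loaded.qubits]
      simp [Test.Holds, var, NatExpr.eval, hs'.index, this]
    · intro j hj s' hs'
      exact Runs.of_loopFree (by simp [scanBody, incr, Cmd.LoopFree])
        (scanBody_spec ⟨j, hj⟩ (h.loaded.letter m hm ⟨j, hj⟩) (h.loaded.basis ⟨j, hj⟩)
          (h.loaded.greedy ⟨j, hj⟩) (h.loaded.sign ⟨j, hj⟩) hs')
  · intro s₂ hs₂
    exact Runs.of_loopFree (by simp [scanFinish, incr, Cmd.LoopFree]) (scanFinish_spec hm h hs₂)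

/-- The greedy choice at a qubit with local field `g` and coin `b`. -/
noncomputable def opposeField (g : ℝ) (b : Bool) : Bool :=
  if 0 < g then true else if g < 0 then false else b

/-- The invariant of the output loop. -/
structure OutputInv (B : Fin n → Fin 4) (y : Fin n → Bool) (g : Fin n → ℝ) (j : ℕ) (s : State) :
    Prop where
  qubits : s.nat 0 0 = n
  index : s.nat 2 0 = j
  basis : ∀ i : Fin n, s.nat 10 i = B i
  sign : ∀ i : Fin n, j ≤ i → s.nat 13 i = (y i).toNat
  field : ∀ i : Fin n, s.real 2 i = g i
  output : ∀ l : Fin n, l.val < j → ∀ a : Fin 3, s.real 1 (3 * (l : ℕ) + (a : ℕ)) =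
    if a.succ = B l then coinSign (opposeField (g l) (y l)) else 0
  rest : ∀ x, 3 * j ≤ x → s.real 1 x = 0

/-- The array `A` is the sign array after the greedy choice, of which the entries of the earlier
qubits are not read again. -/
theorem outputBody_run {s : State} {g : Fin n → ℝ} (j : Fin n) (h : OutputInv B y g j s) :
    ∃ A : ℕ → ℕ, (∀ i : ℕ, i ≠ j → A i = s.nat 13 i) ∧ outputBody.run ω s =
      { nat := Function.update (Function.update s.nat 13 A) 2
          (Function.update (s.nat 2) 0 (j + 1))
        real := Function.update s.real 1 (Function.update (s.real 1) (3 * j + B j - 1)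
          (coinSign (opposeField (g j) (y j))))
        coins := s.coins } := by
  have h2 := h.index
  have h10 := h.basis j
  have h13 := h.sign j le_rfl
  have hg := h.field j
  have h3 : (j : ℕ) + (j + j) = 3 * j := by ring
  rcases lt_trichotomy (g j) 0 with hlt | heq | hgt
  · refine ⟨Function.update (s.nat 13) j 0, fun i hi => Function.update_of_ne hi _ _, ?_⟩
    simp [outputBody, incr, var, Cmd.run, State.setNat, State.setReal, NatExpr.eval, RealExpr.eval,
      Test.Holds, h2, h10, hg, hlt, hlt.not_gt, h3, opposeField, coinSign]
  · refine ⟨s.nat 13, fun _ _ => rfl, ?_⟩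
    cases hy : y j <;>
      simp [outputBody, incr, var, Cmd.run, State.setNat, State.setReal, NatExpr.eval,
        RealExpr.eval, Test.Holds, h2, h10, hg, heq, h3, h13, hy, opposeField, coinSign]
  · refine ⟨Function.update (s.nat 13) j 1, fun i hi => Function.update_of_ne hi _ _, ?_⟩
    simp [outputBody, incr, var, Cmd.run, State.setNat, State.setReal, NatExpr.eval, RealExpr.eval,
      Test.Holds, h2, h10, hg, hgt, h3, opposeField, coinSign]

theorem outputBody_spec {s : State} {g : Fin n → ℝ} (hB : ∀ i, B i ≠ 0) (j : Fin n)
    (h : OutputInv B y g j s) : OutputInv B y g (j + 1) (outputBody.run ω s) := by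
  obtain ⟨A, hA, hrun⟩ := outputBody_run (ω := ω) j h
  rw [hrun]
  have hBj : 0 < (B j).val := Fin.pos_iff_ne_zero.mpr (hB j)
  have hB4 := (B j).isLt
  constructor
  · simpa using h.qubits
  · simp
  · simpa using h.basis
  · intro i hi
    have := h.sign i (by omega)
    simpa [hA i (by omega)] using this
  · simpa using h.field
  · intro l hl a
    by_cases hlj : l = j
    · subst hlj
      have h0 := h.rest (3 * (l : ℕ) + a) (by omega)
      by_cases ha : a.succ = B l
      · have hav : (a : ℕ) + 1 = (B l).val := by rw [← ha]; rfl
        have : 3 * (l : ℕ) + (a : ℕ) = 3 * l + B l - 1 := by omega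
        simp [ha, this]
      · have hav : (a : ℕ) + 1 ≠ (B l).val := fun h => ha (Fin.ext h)
        have : 3 * (l : ℕ) + (a : ℕ) ≠ 3 * l + B l - 1 := by omega
        simp [ha, this, h0]
    · have hne : (l : ℕ) ≠ j := fun h => hlj (Fin.ext h)
      have ha := a.isLt
      have : 3 * (l : ℕ) + (a : ℕ) ≠ 3 * j + B j - 1 := by omega
      simpa [this] using h.output l (by omega) a
  · intro x hx
    have : x ≠ 3 * j + B j - 1 := by omega
    simpa [this] using h.rest x (by omega)

/-- What the program does with a given sequence of coins. -/
theorem greedyProgram_spec (hB : ∀ i : Fin n, (B i : ℕ) = tapeLetter ω i)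
    (hU : ∀ i : Fin n, i ∈ U ↔ ω (4 * i + 2) = true) (hy : ∀ i : Fin n, y i = ω (4 * i + 3)) :
    Runs ω greedyProgram (inputState k L) (50 * (n + L.length + 1) ^ 2) fun s =>
      ∀ (i : Fin n) (a : Fin 3), s.real 1 (3 * (i : ℕ) + (a : ℕ)) =
        if a.succ = B i then
          coinSign (opposeField (L.map fun q => q.1 * activeSign k B U y i q.2).sum (y i))
        else 0 := by
  set g : Fin n → ℝ := fun i => (L.map fun q => q.1 * activeSign k B U y i q.2).sum
  have hB0 : ∀ i, B i ≠ 0 := fun i h => by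
    have := hB i
    rw [h, tapeLetter] at this
    simp at this
    omega
  set s₀ := inputState k L with hs₀
  have htoss : Runs ω (.loop (.natLt (var 2) (.get 0 (.const 0))) tossBody) s₀
      (n * (tossBody.cost + 1) + 1) (FieldInv k L B U y 0) := by
    refine Runs.mono (Runs.loop (I := TossInv ω s₀) ?_ ?_ ?_) le_rfl ?_
    · intro j _ s hs
      simp [Test.Holds, var, NatExpr.eval, hs.index, hs.low.1, hs₀, inputState]
    · exact fun j _ s hs => Runs.of_loopFree (by simp [tossBody, incr, Cmd.LoopFree])
        (tossBody_spec hs)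
    · constructor <;> simp [hs₀, inputState]
    · intro s hs
      obtain ⟨l0, l1, l3, l4⟩ := hs.low
      constructor
      · constructor
        · simp [l0, hs₀, inputState]
        · simp [l0, hs₀, inputState]
        · simp [l0, hs₀, inputState]
        · intro m hm i
          rw [l1, ← getD_flatMap_ofFn L m hm i]
          simp [hs₀, inputState]
        · intro m hm
          simp [hs.real, hs₀, inputState, hm]
        · intro i
          rw [hs.letter i i.isLt, hB]
        · intro i
          rw [hs.greedy i i.isLt]
          by_cases h : ω (4 * i + 2) = true
          · simp [(hU i).mpr h, h]
          · have := mt (hU i).mp h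
            simp [this, h]
        · intro i
          rw [hs.sign i i.isLt, hy]
        · simp [hs.real, hs₀, inputState]
      · simp [l3, hs₀, inputState]
      · simp [l4, hs₀, inputState]
      · simp [hs.real, hs₀, inputState]
  have hterms : ∀ s, FieldInv k L B U y 0 s →
      Runs ω (.loop (.natLt (var 3) (.get 0 (.const 2))) termBody) s
        (L.length * ((6 + ((n * (scanBody.cost + 1) + 1) + scanFinish.cost)) + 1) + 1)
        (FieldInv k L B U y L.length) := fun s hs => by
    refine Runs.loop ?_ (fun m hm s hs => termBody_spec hm hs) hs
    intro m _ s hs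
    simp [Test.Holds, var, NatExpr.eval, hs.term, hs.loaded.terms]
  have hclear : ∀ s, FieldInv k L B U y L.length s → Runs ω (clear 2) s 1 (OutputInv B y g 0) :=
    fun s hs => by
      refine Runs.of_loopFree (c := clear 2) trivial ?_
      change OutputInv B y g 0 (s.setNat 2 0 0)
      constructor
      · simp [State.setNat, hs.loaded.qubits]
      · simp [State.setNat]
      · simp [State.setNat, hs.loaded.basis]
      · simp [State.setNat, hs.loaded.sign]
      · intro i
        simpa [State.setNat] using hs.field i
      · simp
      · simp [State.setNat, hs.loaded.output]
  have hout : ∀ s, OutputInv B y g 0 s →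
      Runs ω (.loop (.natLt (var 2) (.get 0 (.const 0))) outputBody) s
        (n * (outputBody.cost + 1) + 1) (OutputInv B y g n) := fun s hs => by
    refine Runs.loop ?_ (fun j hj s hs => Runs.of_loopFree
      (by simp [outputBody, incr, Cmd.LoopFree]) (outputBody_spec hB0 ⟨j, hj⟩ hs)) hs
    intro j _ s hs
    simp [Test.Holds, var, NatExpr.eval, hs.index, hs.qubits]
  refine Runs.mono (Runs.seq htoss fun s hs => Runs.seq (hterms s hs) fun s hs =>
    Runs.seq (hclear s hs) hout) ?_ fun s hs i a => hs.output i i.isLt a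
  have c1 : tossBody.cost = 6 := rfl
  have c2 : scanBody.cost = 10 := rfl
  have c3 : scanFinish.cost = 6 := rfl
  have c4 : outputBody.cost = 9 := rfl
  rw [c1, c2, c3, c4]
  nlinarith [Nat.zero_le (n * L.length), Nat.zero_le (n * n), Nat.zero_le (L.length * L.length)]

end Program

/-! ### From the polynomial to the Hamiltonian -/

/-- The word with the letters of `B` on `S`. -/
def restrictWord {n : ℕ} (B : Fin n → Fin 4) (S : Finset (Fin n)) : Fin n → Fin 4 :=
  fun i => if i ∈ S then B i else 0

theorem pauliSupport_restrictWord {n : ℕ} {B : Fin n → Fin 4} (hB : ∀ i, B i ≠ 0)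
    (S : Finset (Fin n)) : pauliSupport (restrictWord B S) = S := by
  ext i
  by_cases h : i ∈ S <;> simp [pauliSupport, restrictWord, h, hB]

theorem restrictWord_pauliSupport {n : ℕ} {B P : Fin n → Fin 4}
    (hP : ∀ i, P i ≠ 0 → P i = B i) : restrictWord B (pauliSupport P) = P := by
  ext1 i
  by_cases h : P i = 0
  · simp [restrictWord, pauliSupport, h]
  · simp [restrictWord, pauliSupport, h, ← hP i h]

/-- Sums over the words that agree with `B` are sums over sets of qubits. -/
theorem sum_restrictWord {n : ℕ} {B : Fin n → Fin 4} (hB : ∀ i, B i ≠ 0)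
    (A : (Fin n → Fin 4) → ℝ) (F : Finset (Fin n) → ℝ) :
    ∑ P : Fin n → Fin 4, (if ∀ i, P i ≠ 0 → P i = B i then A P * F (pauliSupport P) else 0) =
      ∑ S, A (restrictWord B S) * F S := by
  rw [← Finset.sum_filter]
  refine Finset.sum_nbij' pauliSupport (restrictWord B) (by simp) ?_ ?_ ?_ ?_
  · intro S _
    simp only [Finset.mem_filter, Finset.mem_univ, true_and, restrictWord]
    intro i hi
    by_cases h : i ∈ S
    · simp [h]
    · simp [h] at hi
  · exact fun P hP => restrictWord_pauliSupport (Finset.mem_filter.mp hP).2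
  · exact fun S _ => pauliSupport_restrictWord hB S
  · intro P hP
    rw [restrictWord_pauliSupport (Finset.mem_filter.mp hP).2]

theorem energy_pauliWord_productState {n : ℕ} {B : Fin n → Fin 4} {x : Fin n → Bool}
    {v : Fin n → Fin 2 → ℂ}
    (hv : ∀ i p, star (v i) ⬝ᵥ (pauli p).mulVec (v i) =
      if p = 0 then 1 else if p = B i then (coinSign (x i) : ℂ) else 0) (P : Fin n → Fin 4) :
    energy (pauliWord P) (productState v) =
      if ∀ i, P i ≠ 0 → P i = B i then character (pauliSupport P) x else 0 := by
  rw [energy, pauliWord_eq_tensorOp, expectation_tensorOp]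
  simp only [hv]
  split_ifs with h
  · have : ∀ i, (if P i = 0 then (1 : ℂ) else if P i = B i then (coinSign (x i) : ℂ) else 0) =
        ((if P i ≠ 0 then coinSign (x i) else 1 : ℝ) : ℂ) := fun i => by
      by_cases h0 : P i = 0
      · simp [h0]
      · simp [h0, ← h i h0]
    simp only [this]
    rw [← Complex.ofReal_prod, Complex.ofReal_re, ← Finset.prod_filter]
    rfl
  · push Not at h
    obtain ⟨i, hi0, hi⟩ := h
    rw [Finset.prod_eq_zero (Finset.mem_univ i) (by simp [hi0, hi]), Complex.zero_re]

theorem energy_productState {n : ℕ} {B : Fin n → Fin 4} (hB : ∀ i, B i ≠ 0) {x : Fin n → Bool}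
    {v : Fin n → Fin 2 → ℂ}
    (hv : ∀ i p, star (v i) ⬝ᵥ (pauli p).mulVec (v i) =
      if p = 0 then 1 else if p = B i then (coinSign (x i) : ℂ) else 0)
    {L : List (ℝ × (Fin n → Fin 4))} {H : QubitOp n} (hL : PauliSumOf L H) :
    energy H (productState v) = ∑ S, pauliCoeff H (restrictWord B S) * character S x := by
  rw [energy_eq_sum_pauliCoeff hL, ← sum_restrictWord hB (pauliCoeff H) fun S => character S x]
  refine Finset.sum_congr rfl fun P _ => ?_
  rw [energy_pauliWord_productState hv, mul_ite, mul_zero]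

/-- The local field computed term by term from the input is that of the energy polynomial. -/
theorem sum_activeSign_eq_localField {n k : ℕ} {B : Fin n → Fin 4} (hB : ∀ i, B i ≠ 0)
    (U : Finset (Fin n)) (y : Fin n → Bool) {L : List (ℝ × (Fin n → Fin 4))} {H : QubitOp n}
    (hL : PauliSumOf L H) (i : Fin n) :
    (L.map fun q => q.1 * activeSign k B U y i q.2).sum =
      localField (fun S => pauliCoeff H (restrictWord B S)) k U i y := by
  rw [list_sum_eq_sum_pauliCoeff hL, localField, activeSets, Finset.sum_filter]
  have h := sum_restrictWord hB (pauliCoeff H)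
    fun S => if S.card = k ∧ S ∩ U = {i} then character (S.erase i) y else 0
  simp only [mul_ite, mul_zero] at h
  rw [← h]
  refine Finset.sum_congr rfl fun P _ => ?_
  rw [activeSign, mul_ite, mul_zero]
  unfold IsActiveWord
  split_ifs <;> tauto

/-! ### Averaging over the bases and the greedy set -/

/-- The letter of a chosen basis, from two coins. -/
def coinLetter (c c' : Bool) : Fin 4 := if c then (if c' then 3 else 2) else (if c' then 2 else 1)

theorem coinLetter_ne_zero (c c' : Bool) : coinLetter c c' ≠ 0 := by
  cases c <;> cases c' <;> decide

theorem coinLetter_val (c c' : Bool) :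
    (coinLetter c c' : ℕ) = 1 + (c.toNat + c'.toNat) := by
  cases c <;> cases c' <;> rfl

theorem exists_coinLetter_eq {p : Fin 4} (hp : p ≠ 0) : ∃ c c', coinLetter c c' = p := by
  revert p
  decide

/-- The chosen bases, from the first two coins of each qubit. -/
def basisOf {n : ℕ} (z : Fin n × Fin 3 → Bool) (i : Fin n) : Fin 4 :=
  coinLetter (z (i, 0)) (z (i, 1))

/-- The greedy set, from the third coin of each qubit. -/
def greedySet {n : ℕ} (z : Fin n × Fin 3 → Bool) : Finset (Fin n) :=
  Finset.univ.filter fun i => z (i, 2) = true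

/-- A given word survives the choice of bases, with a given one of its letters the only one in the
greedy set, with probability at least `8 ^ (-k)`: overwriting the coins of the `k` qubits by
suitable ones loses no more than those coins. -/
theorem card_good_coins_ge {n k : ℕ} {P : Fin n → Fin 4} (hP : (pauliSupport P).card = k)
    {i₀ : Fin n} (hi₀ : i₀ ∈ pauliSupport P) :
    8 ^ n ≤ 8 ^ k * (Finset.univ.filter fun z : Fin n × Fin 3 → Bool =>
      (∀ i, P i ≠ 0 → P i = basisOf z i) ∧ pauliSupport P ∩ greedySet z = {i₀}).card := by
  have hex : ∀ i, ∃ c c', P i ≠ 0 → coinLetter c c' = P i := fun i => by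
    by_cases h : P i = 0
    · exact ⟨true, true, fun h' => absurd h h'⟩
    · obtain ⟨c, c', hc⟩ := exists_coinLetter_eq h
      exact ⟨c, c', fun _ => hc⟩
  choose c c' hc using hex
  have hsupp : ∀ i, i ∈ pauliSupport P ↔ P i ≠ 0 := fun i => by simp [pauliSupport]
  set good := Finset.univ.filter fun z : Fin n × Fin 3 → Bool =>
      (∀ i, P i ≠ 0 → P i = basisOf z i) ∧ pauliSupport P ∩ greedySet z = {i₀} with hgood
  let pat : Fin n × Fin 3 → Bool := fun q => ![c q.1, c' q.1, decide (q.1 = i₀)] q.2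
  let patch : (Fin n × Fin 3 → Bool) → (Fin n × Fin 3 → Bool) := fun z q =>
    if q.1 ∈ pauliSupport P then pat q else z q
  have h_patch : ∀ z, patch z ∈ good := fun z => by
    rw [hgood, Finset.mem_filter]
    refine ⟨Finset.mem_univ _, fun i hi => ?_, ?_⟩
    · simp [basisOf, patch, pat, (hsupp i).mpr hi, hc i hi]
    · ext j
      simp only [greedySet, Finset.mem_inter, Finset.mem_filter, Finset.mem_univ, true_and,
        Finset.mem_singleton]
      constructor
      · rintro ⟨hj, hj'⟩
        simpa [patch, pat, hj] using hj'
      · rintro rfl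
        exact ⟨hi₀, by simp [patch, pat, hi₀]⟩
  let f : (Fin n × Fin 3 → Bool) → good × (pauliSupport P × Fin 3 → Bool) := fun z =>
    (⟨patch z, h_patch z⟩, fun q => z (q.1, q.2))
  have hf : Function.Injective f := fun z z' h => by
    have h1 : patch z = patch z' := congrArg (fun w => w.1.1) h
    have h2 := congrArg Prod.snd h
    ext1 q
    by_cases hq : q.1 ∈ pauliSupport P
    · exact congrFun h2 (⟨q.1, hq⟩, q.2)
    · simpa [patch, hq] using congrFun h1 q
  have hcard := Fintype.card_le_of_injective f hf
  simp only [Fintype.card_fun, Fintype.card_prod, Fintype.card_bool, Fintype.card_fin,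
    Fintype.card_coe, hP] at hcard
  rw [mul_comm n 3, mul_comm k 3, pow_mul, pow_mul] at hcard
  norm_num at hcard
  linarith

/-- The expected sum of the squared coefficients of the active terms is at least `8 ^ (-k)` times
`strictWeight k H`; the sum over `z` is `8 ^ n` times the expectation. -/
theorem strictWeight_le_sum_activeSets {n k : ℕ} (hk : 1 ≤ k) (H : QubitOp n) :
    8 ^ n * strictWeight k H ≤ 8 ^ k * ∑ z : Fin n × Fin 3 → Bool, ∑ i,
      ∑ S ∈ activeSets k (greedySet z) i, pauliCoeff H (restrictWord (basisOf z) S) ^ 2 := by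
  have hz : ∀ z : Fin n × Fin 3 → Bool, ∀ i,
      ∑ S ∈ activeSets k (greedySet z) i, pauliCoeff H (restrictWord (basisOf z) S) ^ 2 =
      ∑ P : Fin n → Fin 4, if ((∀ j, P j ≠ 0 → P j = basisOf z j) ∧
        pauliSupport P ∩ greedySet z = {i}) ∧ (pauliSupport P).card = k
        then pauliCoeff H P ^ 2 else 0 := fun z i => by
    rw [activeSets, Finset.sum_filter]
    have h := sum_restrictWord (B := basisOf z) (fun j => coinLetter_ne_zero _ _)
      (fun P => pauliCoeff H P ^ 2)
      fun S => if S.card = k ∧ S ∩ greedySet z = {i} then 1 else 0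
    simp only [mul_ite, mul_zero, mul_one] at h
    rw [← h]
    refine Finset.sum_congr rfl fun P _ => ?_
    split_ifs <;> tauto
  have hswap : ∑ z : Fin n × Fin 3 → Bool, ∑ i,
      ∑ S ∈ activeSets k (greedySet z) i, pauliCoeff H (restrictWord (basisOf z) S) ^ 2 =
      ∑ P : Fin n → Fin 4, ∑ i, ∑ z : Fin n × Fin 3 → Bool,
        if ((∀ j, P j ≠ 0 → P j = basisOf z j) ∧
        pauliSupport P ∩ greedySet z = {i}) ∧ (pauliSupport P).card = k
        then pauliCoeff H P ^ 2 else 0 := by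
    simp only [hz]
    rw [Finset.sum_congr rfl fun z _ => Finset.sum_comm, Finset.sum_comm]
    exact Finset.sum_congr rfl fun P _ => Finset.sum_comm
  rw [hswap, strictWeight, Finset.sum_filter, Finset.mul_sum, Finset.mul_sum]
  refine Finset.sum_le_sum fun P _ => ?_
  have hnn : ∀ i, 0 ≤ ∑ z : Fin n × Fin 3 → Bool,
      if ((∀ j, P j ≠ 0 → P j = basisOf z j) ∧
        pauliSupport P ∩ greedySet z = {i}) ∧ (pauliSupport P).card = k
        then pauliCoeff H P ^ 2 else 0 := fun i => Finset.sum_nonneg fun z _ => by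
    split_ifs
    · exact sq_nonneg _
    · exact le_rfl
  by_cases hP : (pauliSupport P).card = k
  · obtain ⟨i₀, hi₀⟩ : (pauliSupport P).Nonempty := Finset.card_pos.mp (by omega)
    have hc : (8 : ℝ) ^ n ≤ 8 ^ k * ((Finset.univ.filter fun z : Fin n × Fin 3 → Bool =>
        (∀ i, P i ≠ 0 → P i = basisOf z i) ∧ pauliSupport P ∩ greedySet z = {i₀}).card : ℝ) := by
      exact_mod_cast card_good_coins_ge hP hi₀
    have hle := Finset.single_le_sum (fun i _ => hnn i) (Finset.mem_univ i₀)
    simp only [hP, and_true] at hle ⊢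
    rw [← Finset.sum_filter, Finset.sum_const, nsmul_eq_mul] at hle
    rw [if_pos trivial]
    calc 8 ^ n * pauliCoeff H P ^ 2 ≤ (8 ^ k * _) * pauliCoeff H P ^ 2 :=
          mul_le_mul_of_nonneg_right hc (sq_nonneg _)
      _ = 8 ^ k * (_ * pauliCoeff H P ^ 2) := mul_assoc _ _ _
      _ ≤ _ := mul_le_mul_of_nonneg_left hle (by positivity)
  · rw [if_neg hP, mul_zero]
    exact mul_nonneg (by positivity) (Finset.sum_nonneg fun i _ => hnn i)

/-! ### The random tape -/

/-- Only the entries of the tape that are read matter. -/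
theorem sum_comp_injective {ι κ : Type*} [Fintype ι] [Fintype κ] [DecidableEq ι] [DecidableEq κ]
    {e : ι → κ} (he : Function.Injective e) (F : (ι → Bool) → ℝ) :
    2 ^ Fintype.card ι * ∑ r : κ → Bool, F (r ∘ e) = 2 ^ Fintype.card κ * ∑ w, F w := by
  classical
  let e' : ι ≃ {x // x ∈ Set.range e} := Equiv.ofInjective e he
  have h1 : ∑ r : κ → Bool, F (r ∘ e) =
      ∑ q : ({x // x ∈ Set.range e} → Bool) × ({x // x ∉ Set.range e} → Bool), F (q.1 ∘ e') :=
    Fintype.sum_equiv (Equiv.piEquivPiSubtypeProd (fun x => x ∈ Set.range e) fun _ => Bool) _ _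
      fun r => rfl
  have h2 : ∑ q : {x // x ∈ Set.range e} → Bool, F (q ∘ e') = ∑ w, F w :=
    Fintype.sum_equiv (Equiv.arrowCongr e'.symm (Equiv.refl Bool)) _ _ fun r => rfl
  have hcard : Fintype.card κ = Fintype.card ι + Fintype.card {x // x ∉ Set.range e} := by
    rw [Fintype.card_congr e', ← Fintype.card_sum]
    exact Fintype.card_congr (Equiv.sumCompl _).symm
  rw [h1, Fintype.sum_prod_type]
  simp only [Finset.sum_const, Finset.card_univ, nsmul_eq_mul, ← Finset.mul_sum, h2, hcard,
    Fintype.card_fun, Fintype.card_bool]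
  push_cast
  rw [pow_add]
  ring

theorem sum_tape {ι₁ ι₂ : Type*} [Fintype ι₁] [Fintype ι₂] [DecidableEq ι₁] [DecidableEq ι₂]
    {T : ℕ} {e₁ : ι₁ → Fin T} {e₂ : ι₂ → Fin T} (he : Function.Injective (Sum.elim e₁ e₂))
    (F : (ι₁ → Bool) → (ι₂ → Bool) → ℝ) :
    2 ^ (Fintype.card ι₁ + Fintype.card ι₂) * ∑ r : Fin T → Bool, F (r ∘ e₁) (r ∘ e₂) =
      2 ^ T * ∑ z, ∑ y, F z y := by
  have h := sum_comp_injective he fun w => F (w ∘ Sum.inl) (w ∘ Sum.inr)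
  rw [Fintype.card_sum, Fintype.card_fin] at h
  rw [← Fintype.sum_prod_type' F, ← Fintype.sum_equiv (Equiv.sumArrowEquivProdArrow ι₁ ι₂ Bool)
    (fun w => F (w ∘ Sum.inl) (w ∘ Sum.inr)) _ fun w => rfl]
  exact h

/-- The mean energy of the states `v z y` whose Bloch vectors are given by the greedy choices. -/
theorem sum_energy_le {n k : ℕ} {E : Finset (Finset (Fin n))} {h : Finset (Fin n) → QubitOp n}
    {L : List (ℝ × (Fin n → Fin 4))} (hk : 1 ≤ k) (hloc : IsLocalFamily k E h)
    (htri : HypergraphTriangleFree E) (hL : PauliSumOf L (∑ R ∈ E, h R))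
    (v : (Fin n × Fin 3 → Bool) → (Fin n → Bool) → Fin n → Fin 2 → ℂ)
    (hv : ∀ z y i p, star (v z y i) ⬝ᵥ (pauli p).mulVec (v z y i) =
      if p = 0 then 1 else if p = basisOf z i then
        (coinSign (greedyCoins (fun S => pauliCoeff (∑ R ∈ E, h R) (restrictWord (basisOf z) S))
          k (greedySet z) y i) : ℂ) else 0) :
    ∑ z, ∑ y, energy (∑ R ∈ E, h R) (productState (v z y)) ≤
      8 ^ n * 2 ^ n * (pauliCoeff (∑ R ∈ E, h R) 0 -
        1 / 2 * (strictWeight k (∑ R ∈ E, h R) / (√(hypergraphMaxDegree E : ℝ) * 8 ^ k))) := by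
  set H := ∑ R ∈ E, h R with hH
  have hcard : ∀ R ∈ E, R.card ≤ k := fun R hR => (hloc R hR).1
  have hB : ∀ (z : Fin n × Fin 3 → Bool) i, basisOf z i ≠ 0 := fun z i => coinLetter_ne_zero _ _
  set G : (Fin n × Fin 3 → Bool) → Fin n → ℝ := fun z i =>
    ∑ S ∈ activeSets k (greedySet z) i, pauliCoeff H (restrictWord (basisOf z) S) ^ 2 with hG
  set D := √(hypergraphMaxDegree E : ℝ) with hD
  have hz : ∀ z, ∑ y, energy H (productState (v z y)) ≤
      2 ^ n * pauliCoeff H 0 - 2 ^ n * (1 / 2 * ((∑ i, G z i) / D)) := fun z => by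
    have ha : ∀ S, pauliCoeff H (restrictWord (basisOf z) S) ≠ 0 → ∃ R ∈ E, S ⊆ R :=
      fun S hS => by simpa only [pauliSupport_restrictWord (hB z)] using
        exists_support_subset hloc hS
    have ha1 : ∀ S, S.card = k → |pauliCoeff H (restrictWord (basisOf z) S)| ≤ 1 := fun S hS =>
      abs_pauliCoeff_le_of_card_eq hloc (by rw [pauliSupport_restrictWord (hB z), hS])
    have h0 : restrictWord (basisOf z) ∅ = 0 := by ext; simp [restrictWord]
    simp only [fun y => energy_productState (hB z) (hv z y) hL]
    rw [sum_polynomial_greedyCoins hcard htri ha, h0, Finset.sum_div, Finset.mul_sum,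
      Finset.mul_sum]
    refine sub_le_sub_left (Finset.sum_le_sum fun i _ => ?_) _
    exact le_sum_abs_localField (greedySet z) hcard htri ha ha1 i
      (Finset.le_sup (f := fun i => (E.filter fun R => i ∈ R).card) (Finset.mem_univ i))
  have hw := strictWeight_le_sum_activeSets hk H
  change _ ≤ 8 ^ k * ∑ z, ∑ i, G z i at hw
  have hcz : (Fintype.card (Fin n × Fin 3 → Bool) : ℝ) = 8 ^ n := by
    rw [Fintype.card_fun, Fintype.card_prod, Fintype.card_fin, Fintype.card_fin, mul_comm, pow_mul]
    norm_num
  refine (Finset.sum_le_sum fun z _ => hz z).trans ?_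
  rw [Finset.sum_sub_distrib, Finset.sum_const, Finset.card_univ, nsmul_eq_mul, hcz,
    ← Finset.mul_sum, ← Finset.mul_sum, ← Finset.sum_div]
  have h8 : 8 ^ n * (strictWeight k H / (D * 8 ^ k)) ≤ (∑ z, ∑ i, G z i) / D := by
    rw [mul_div_assoc', mul_comm D, ← div_div]
    refine div_le_div_of_nonneg_right ?_ (Real.sqrt_nonneg _)
    rwa [div_le_iff₀' (by positivity)]
  have h2 : (0 : ℝ) < 2 ^ n := by positivity
  nlinarith

theorem theorem1 :
    ∃ (prog : RealRAM.Cmd) (p : Polynomial ℕ) (c : ℝ) (C₁ C₂ : ℕ), 0 < c ∧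
      ∀ (n k : ℕ) (E : Finset (Finset (Fin n))) (h : Finset (Fin n) → QubitOp n)
        (H : QubitOp n) (L : List (ℝ × (Fin n → Fin 4))) (T : ℕ),
        1 ≤ k → IsLocalFamily k E h → HypergraphTriangleFree E →
        H = ∑ R ∈ E, h R → PauliSumOf L H → T = p.eval (n + L.length) →
        ∃ v : (Fin T → Bool) → Fin n → Fin 2 → ℂ,
          (∀ r : Fin T → Bool, ∃ t ≤ T, ∃ s : RealRAM.State,
            RealRAM.Exec (RealRAM.tape r) prog (inputState k L) t s ∧ OutputsState s (v r)) ∧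
          (∑ r : Fin T → Bool, energy H (productState (v r))) / 2 ^ T ≤
            (Matrix.trace H).re / 2 ^ n -
              c * (strictWeight k H /
                (√(hypergraphMaxDegree E : ℝ) * 3 ^ (C₁ * k) * 2 ^ (C₂ * k))) := by
  refine ⟨greedyProgram, Polynomial.C 50 * (Polynomial.X + 1) ^ 2, 1 / 2, 0, 3, by norm_num, ?_⟩
  intro n k E h H L T hk hloc htri hH hL hT
  subst hH
  set H := ∑ R ∈ E, h R with hH
  have hT' : T = 50 * (n + L.length + 1) ^ 2 := by simpa using hT
  have hTn : 4 * n ≤ T := by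
    have := Nat.le_self_pow two_ne_zero (n + L.length + 1)
    omega
  have hB : ∀ (z : Fin n × Fin 3 → Bool) i, basisOf z i ≠ 0 := fun z i => coinLetter_ne_zero _ _
  -- the states
  have hex : ∀ (z : Fin n × Fin 3 → Bool) (y : Fin n → Bool) (i : Fin n), ∃ ψ : Fin 2 → ℂ,
      ∀ p, star ψ ⬝ᵥ (pauli p).mulVec ψ = if p = 0 then 1 else if p = basisOf z i then
        (coinSign (greedyCoins (fun S => pauliCoeff H (restrictWord (basisOf z) S))
          k (greedySet z) y i) : ℂ) else 0 := fun z y i =>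
    exists_qubit_state _ (hB z i) _ (coinSign_eq_or _)
  choose w hw using hex
  -- the coins of qubit `i` are the entries `4 i, …, 4 i + 3` of the tape
  let e₁ : Fin n × Fin 3 → Fin T := fun q => ⟨4 * q.1 + q.2, by omega⟩
  let e₂ : Fin n → Fin T := fun i => ⟨4 * i + 3, by omega⟩
  have he : Function.Injective (Sum.elim e₁ e₂) := by
    rintro (⟨i, a⟩ | i) (⟨j, b⟩ | j) hij <;>
      simp only [Sum.elim_inl, Sum.elim_inr, e₁, e₂, Fin.mk.injEq] at hij
    · have hi : i = j := Fin.ext (by omega)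
      have ha : a = b := Fin.ext (by omega)
      rw [hi, ha]
    · omega
    · omega
    · have hi : i = j := Fin.ext (by omega)
      rw [hi]
  refine ⟨fun r => w (r ∘ e₁) (r ∘ e₂), fun r => ?_, ?_⟩
  · have htape : ∀ (i : Fin n) (a : ℕ) (ha : a < 4),
        tape r (4 * i + a) = r ⟨4 * i + a, by omega⟩ := fun i a ha => by
      rw [tape, dif_pos]
    obtain ⟨t, ht, s, hs, hout⟩ := greedyProgram_spec (k := k) (L := L) (ω := tape r)
      (B := basisOf (r ∘ e₁)) (U := greedySet (r ∘ e₁)) (y := r ∘ e₂)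
      (fun i => by
        have h0 : tape r (4 * (i : ℕ)) = r (e₁ (i, 0)) := htape i 0 (by norm_num)
        rw [basisOf, coinLetter_val, tapeLetter, htape i 1 (by norm_num), h0]
        rfl)
      (fun i => by
        rw [htape i 2 (by norm_num)]
        simp [greedySet, e₁])
      (fun i => by rw [htape i 3 (by norm_num)]; rfl)
    refine ⟨t, ht.trans hT'.ge, s, hs, fun i => ⟨?_, fun a => ?_⟩⟩
    · simpa [pauli] using hw (r ∘ e₁) (r ∘ e₂) i 0
    · rw [hout i a, blochVector, hw, sum_activeSign_eq_localField (hB _) _ _ hL,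
        if_neg (Fin.succ_ne_zero a)]
      split_ifs
      · rw [Complex.ofReal_re]
        rfl
      · rfl
  · have hsum := sum_tape he fun z y => energy H (productState (w z y))
    have hle := sum_energy_le hk hloc htri hL w hw
    rw [← hH, pauliCoeff_zero_eq] at hle
    have h8 : (2 : ℝ) ^ (Fintype.card (Fin n × Fin 3) + Fintype.card (Fin n)) = 8 ^ n * 2 ^ n := by
      rw [Fintype.card_prod, Fintype.card_fin, Fintype.card_fin, pow_add, mul_comm n 3, pow_mul]
      norm_num
    have h8k : √(hypergraphMaxDegree E : ℝ) * 3 ^ (0 * k) * 2 ^ (3 * k) =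
        √(hypergraphMaxDegree E : ℝ) * 8 ^ k := by
      rw [zero_mul, pow_zero, mul_one, pow_mul]
      norm_num
    rw [h8] at hsum
    rw [h8k, div_le_iff₀ (by positivity)]
    have hpos : (0 : ℝ) < 8 ^ n * 2 ^ n := by positivity
    refine le_of_mul_le_mul_left ?_ hpos
    rw [hsum]
    calc _ ≤ 2 ^ T * _ := mul_le_mul_of_nonneg_left hle (by positivity)
      _ = _ := by ring
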